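/- Let $(X_t)_{t\ge 0}$ be a discrete-time Markov chain on a measurable space $\mathcal X$ with transition kernel $P$, and let $P^t(x,\cdot)$ be the law of the chain after $t$ steps when started from $x$. All subsets and functions below are measurable. Write $\|\mu-\mu'\|_{\mathrm{TV}}=\sup_{S\subset\mathcal X}|\mu(S)-\mu'(S)|$ for probability measures $\mu,\mu'$, and $r_+=\max(r,0)$ for real $r$. Assume that $P$ is reversible with respect to a probability measure $\pi$, that is, $\pi(dx)P(x,dy)=\pi(dy)P(y,dx)$ on $\mathcal X\times\mathcal X$, and that it has nonnegative eigenvalues, that is, the spectrum of the self-adjoint operator $f\mapsto Pf$, $Pf(x)=\int f(y)\,P(x,dy)$, on the real space $L^2(\pi)$ is contained in $[0,1]$. Let $C\subset\mathcal X$, $V:\mathcal X\to[1,\infty)$, $0<\lambda<1$ and $K<\infty$ satisfy the drift condition $$PV(x)\le \lambda V(x)\ \ (x\notin C),\qquad PV(x)\le K\ \ (x\in C),$$ and let the integer $m\ge 1$, the number $\varepsilon>0$ and the probability measure $\nu$ on $\mathcal X$ satisfy the $m$-step minorization condition $$P^m(x,S)\ge\varepsilon\,\nu(S)\qquad\text{for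 all } x\in C,\ S\subset\mathcal X.$$ Define $$B=\frac{1-\lambda^m}{1-\lambda}(K-\lambda)+\lambda^m.$$ If $\varepsilon=1$, set $\rho=\lambda$ and $r=1$. If $\varepsilon<1$, set $$\rho=\max\left\{\lambda,\ \exp\left(\frac{-\log(1-\varepsilon)\,\log\lambda}{-m\log\lambda+\log(B-\varepsilon)-\log(1-\varepsilon)}\right)\right\},\qquad r=\frac{\log\rho}{\log\lambda}.$$ (The hypotheses force $\varepsilon\le 1$.) Put $$A(\nu)=\left[\frac{B-(1-\varepsilon)}{\varepsilon}\right]^r\rho^{1-m},\qquad A(x)=V(x)^r\rho^{1-m},\qquad D=\frac12\sqrt{\frac{A(\nu)\,\rho}{1-\rho}},$$ $$F(x,t)=\frac{1-\rho}{\rho}\,D\,A(x)\,t+(1-D)_+A(x)+D.$$ Then $\rho<1$ and $$\|P^t(x,\cdot)-\pi\|_{\mathrm{TV}}\le F(x,t)\,\rho^t\qquad\text{for all } x\in\mathcal X \text{ and all integers } t\ge 0.$$ -/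

import Mathlib

open MeasureTheory ProbabilityTheory
open scoped ENNReal

namespace DriftMinorization

variable {X : Type*} [MeasurableSpace X]

/-- Total variation distance `sup_S |μ(S) - μ'(S)|`, the supremum being over measurable sets. -/
noncomputable def tvDist (μ μ' : Measure X) : ℝ :=
  ⨆ S : {S : Set X // MeasurableSet S}, |μ.real S - μ'.real S|

section Operator

/-- If two functions agree `π`-a.e. and `π` is invariant, then their images under `P` agree
`π`-a.e. -/
theorem kernel_integral_congr {P : Kernel X X} {π : Measure X} (hπ : P.Invariant π)
    {f g : X → ℝ} (h : f =ᵐ[π] g) :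
    (fun x ↦ ∫ y, f y ∂(P x)) =ᵐ[π] fun x ↦ ∫ y, g y ∂(P x) := by
  have h' : ∀ᵐ y ∂(P ∘ₘ π), f y = g y := by
    have e : P ∘ₘ π = π := hπ
    rw [e]
    exact h
  filter_upwards [Measure.ae_ae_of_ae_comp h'] with x hx using integral_congr_ae hx

theorem kernel_integral_aestronglyMeasurable {P : Kernel X X} [IsMarkovKernel P] {π : Measure X}
    (hπ : P.Invariant π) {f : X → ℝ} (hf : AEStronglyMeasurable f π) :
    AEStronglyMeasurable (fun x ↦ ∫ y, f y ∂(P x)) π :=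
  ⟨fun x ↦ ∫ y, hf.mk f y ∂(P x), hf.stronglyMeasurable_mk.integral_kernel,
    kernel_integral_congr hπ hf.ae_eq_mk⟩

theorem eLpNorm_two_sq (f : X → ℝ) (μ : Measure X) :
    eLpNorm f 2 μ ^ (2 : ℝ) = ∫⁻ x, ‖f x‖ₑ ^ (2 : ℝ) ∂μ := by
  have := eLpNorm_nnreal_pow_eq_lintegral (f := f) (μ := μ) (p := 2) (by norm_num)
  simpa using this

theorem kernel_integral_eLpNorm_le {P : Kernel X X} [IsMarkovKernel P] {π : Measure X}
    (hπ : P.Invariant π) {f : X → ℝ} (hf : AEStronglyMeasurable f π) :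
    eLpNorm (fun x ↦ ∫ y, f y ∂(P x)) 2 π ≤ eLpNorm f 2 π := by
  have e : P ∘ₘ π = π := hπ
  rw [← ENNReal.rpow_le_rpow_iff (z := 2) (by norm_num), eLpNorm_two_sq, eLpNorm_two_sq]
  have hf' : AEStronglyMeasurable f (P ∘ₘ π) := by rw [e]; exact hf
  have hm : ∀ᵐ x ∂π, AEStronglyMeasurable f (P x) := by
    filter_upwards [Measure.ae_ae_of_ae_comp hf'.ae_eq_mk] with x hx
    exact ⟨_, hf'.stronglyMeasurable_mk, hx⟩
  calc ∫⁻ x, ‖∫ y, f y ∂(P x)‖ₑ ^ (2 : ℝ) ∂π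
      ≤ ∫⁻ x, ∫⁻ y, ‖f y‖ₑ ^ (2 : ℝ) ∂(P x) ∂π := by
        refine lintegral_mono_ae ?_
        filter_upwards [hm] with x hx
        rw [← eLpNorm_two_sq]
        refine ENNReal.rpow_le_rpow ?_ (by norm_num)
        calc ‖∫ y, f y ∂(P x)‖ₑ ≤ ∫⁻ y, ‖f y‖ₑ ∂(P x) := enorm_integral_le_lintegral_enorm _
          _ = eLpNorm f 1 (P x) := eLpNorm_one_eq_lintegral_enorm.symm
          _ ≤ eLpNorm f 2 (P x) :=
            eLpNorm_le_eLpNorm_of_exponent_le (by norm_num) hx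
    _ = ∫⁻ y, ‖f y‖ₑ ^ (2 : ℝ) ∂(P ∘ₘ π) :=
        (Measure.lintegral_bind P.aemeasurable (hf'.enorm.pow_const _)).symm
    _ = ∫⁻ y, ‖f y‖ₑ ^ (2 : ℝ) ∂π := by rw [e]

theorem kernel_integral_memLp {P : Kernel X X} [IsMarkovKernel P] {π : Measure X}
    (hπ : P.Invariant π) {f : X → ℝ} (hf : MemLp f 2 π) :
    MemLp (fun x ↦ ∫ y, f y ∂(P x)) 2 π :=
  ⟨kernel_integral_aestronglyMeasurable hπ hf.1,
    (kernel_integral_eLpNorm_le hπ hf.1).trans_lt hf.2⟩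

theorem ae_integrable_kernel {P : Kernel X X} [IsMarkovKernel P] {π : Measure X}
    [IsProbabilityMeasure π] (hπ : P.Invariant π) {f : X → ℝ} (hf : MemLp f 2 π) :
    ∀ᵐ x ∂π, Integrable f (P x) := by
  have e : P ∘ₘ π = π := hπ
  have h : Integrable f (P ∘ₘ π) := by rw [e]; exact hf.integrable (by norm_num)
  exact Measure.ae_integrable_of_integrable_comp h

/-- The operator `f ↦ Pf`, `Pf(x) = ∫ f(y) P(x,dy)`, on the real Hilbert space `L²(π)`, for a
Markov kernel `P` with stationary distribution `π`. -/
noncomputable def transitionOperator (P : Kernel X X) [IsMarkovKernel P] (π : Measure X)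
    [IsProbabilityMeasure π] (hπ : P.Invariant π) : Lp ℝ 2 π →L[ℝ] Lp ℝ 2 π :=
  LinearMap.mkContinuous
    { toFun := fun f ↦ (kernel_integral_memLp hπ (Lp.memLp f)).toLp (fun x ↦ ∫ y, f y ∂(P x))
      map_add' := by
        intro f g
        rw [← MemLp.toLp_add]
        refine MemLp.toLp_congr _ _ ?_
        filter_upwards [kernel_integral_congr hπ (Lp.coeFn_add f g),
          ae_integrable_kernel hπ (Lp.memLp f), ae_integrable_kernel hπ (Lp.memLp g)]
          with x hx hfx hgx
        rw [hx]
        exact integral_add hfx hgx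
      map_smul' := by
        intro c f
        rw [RingHom.id_apply, ← MemLp.toLp_const_smul]
        refine MemLp.toLp_congr _ _ ?_
        filter_upwards [kernel_integral_congr hπ (Lp.coeFn_smul c f)] with x hx
        rw [hx]
        exact integral_smul c _ }
    1
    (by
      intro f
      rw [one_mul]
      change ‖(kernel_integral_memLp hπ (Lp.memLp f)).toLp _‖ ≤ ‖f‖
      rw [Lp.norm_toLp, Lp.norm_def]
      exact ENNReal.toReal_mono (Lp.memLp f).2.ne (kernel_integral_eLpNorm_le hπ (Lp.memLp f).1))

theorem transitionOperator_ae_eq (P : Kernel X X) [IsMarkovKernel P] (π : Measure X)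
    [IsProbabilityMeasure π] (hπ : P.Invariant π) (f : Lp ℝ 2 π) :
    transitionOperator P π hπ f =ᵐ[π] fun x ↦ ∫ y, f y ∂(P x) :=
  MemLp.coeFn_toLp (kernel_integral_memLp hπ (Lp.memLp f))

/-- A reversible Markov kernel has nonnegative eigenvalues if its spectrum as an operator on
`L²(π)` (where it is self-adjoint) is contained in `[0,1]`. -/
def HasNonnegativeEigenvalues (P : Kernel X X) [IsMarkovKernel P] (π : Measure X)
    [IsProbabilityMeasure π] (hrev : P.IsReversible π) : Prop :=
  spectrum ℝ (transitionOperator P π hrev.invariant) ⊆ Set.Icc 0 1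

end Operator

/-- `V : X → [1,∞)` with constants `lam < 1`, `K < ∞` is a drift function with respect to `C`:
`PV ≤ lam V` off `C` and `PV ≤ K` on `C`. As `V` is positive, `PV` is written as an integral with
values in `[0,∞]`, so its finiteness is part of the condition. -/
structure IsDriftFunction (P : Kernel X X) (C : Set X) (V : X → ℝ) (lam K : ℝ) : Prop where
  measurable : Measurable V
  one_le : ∀ x, 1 ≤ V x
  lam_lt_one : lam < 1
  drift_off : ∀ x, x ∉ C → ∫⁻ y, ENNReal.ofReal (V y) ∂(P x) ≤ ENNReal.ofReal (lam * V x)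
  drift_on : ∀ x, x ∈ C → ∫⁻ y, ENNReal.ofReal (V y) ∂(P x) ≤ ENNReal.ofReal K

/-- `C` is a small set with `m`-step minorization `P^m(x,S) ≥ ε ν(S)`, `x ∈ C`. -/
structure IsSmallSet (P : Kernel X X) (C : Set X) (m : ℕ) (ε : ℝ) (ν : Measure X) : Prop where
  isProbabilityMeasure : IsProbabilityMeasure ν
  one_le : 1 ≤ m
  eps_pos : 0 < ε
  minorization : ∀ x ∈ C, ∀ S, MeasurableSet S → ENNReal.ofReal ε * ν S ≤ (P ^ m) x S

/-- `B = (1 - lam^m)/(1 - lam) (K - lam) + lam^m`. -/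
noncomputable def constB (lam K : ℝ) (m : ℕ) : ℝ :=
  (1 - lam ^ m) / (1 - lam) * (K - lam) + lam ^ m

/-- The rate `ρ`. -/
noncomputable def rate (lam K : ℝ) (m : ℕ) (ε : ℝ) : ℝ :=
  if ε = 1 then lam
  else max lam (Real.exp (-Real.log (1 - ε) * Real.log lam /
    (-(m : ℝ) * Real.log lam + Real.log (constB lam K m - ε) - Real.log (1 - ε))))

/-- The exponent `r`. -/
noncomputable def expo (lam K : ℝ) (m : ℕ) (ε : ℝ) : ℝ :=
  if ε = 1 then 1 else Real.log (rate lam K m ε) / Real.log lam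

/-- `A(ν) = [(B - (1 - ε))/ε]^r ρ^(1-m)`. -/
noncomputable def constAν (lam K : ℝ) (m : ℕ) (ε : ℝ) : ℝ :=
  ((constB lam K m - (1 - ε)) / ε) ^ expo lam K m ε * rate lam K m ε ^ (1 - (m : ℤ))

/-- `A(x) = V(x)^r ρ^(1-m)`, as a function of the value `v = V(x)`. -/
noncomputable def funA (lam K : ℝ) (m : ℕ) (ε : ℝ) (v : ℝ) : ℝ :=
  v ^ expo lam K m ε * rate lam K m ε ^ (1 - (m : ℤ))

/-- `D = (1/2) √(A(ν) ρ / (1 - ρ))`. -/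
noncomputable def constD (lam K : ℝ) (m : ℕ) (ε : ℝ) : ℝ :=
  1 / 2 * √(constAν lam K m ε * rate lam K m ε / (1 - rate lam K m ε))

/-- `F(x,t) = (1 - ρ)/ρ D A(x) t + (1 - D)₊ A(x) + D`, as a function of `v = V(x)` and `t`. -/
noncomputable def funF (lam K : ℝ) (m : ℕ) (ε : ℝ) (v : ℝ) (t : ℕ) : ℝ :=
  (1 - rate lam K m ε) / rate lam K m ε * constD lam K m ε * funA lam K m ε v * t
    + max (1 - constD lam K m ε) 0 * funA lam K m ε v + constD lam K m ε

end DriftMinorization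

/-! The chain is cut at regeneration times. On `C` write `P^m` as `εν` plus a residual kernel `N`.
Off `C` the chain moves one step at a time; on `C` it moves `m` steps at a time and restarts from
`ν` with probability `ε`. If `p_s` is the law of the first restart time from `μ`, then `μP^t ≥
∑_{s≤t} p_s νP^(t-s)` (`sum_smul_comp_le`), and the missing mass is the tail `q_t = 1 - ∑_{s≤t}
p_s`. By Hölder and `λ^r = ρ`, the function `V^r` contracts by `ρ` off `C`, and its integral against
`N` is at most `ρ^m` on `C`; the formula for `ρ` is made for this. Hence `q_t ≤ A ρ^t`
(`one_le_sum_regenProb_add`).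

Reversibility and the nonnegative spectrum carry the rate `ρ` over to `νP^n`. Stationarity makes `π`
dominate a positive multiple of `ν`, so `ν` has a bounded density `f`. With `T` the transition
operator and `g = f - 1`, the numbers `a_n = ∫ f d(νP^n) - 1 = ⟪g, T^n g⟫` are nonnegative
(`correlation_bounds`). Testing the regeneration inequality on `f` gives `∑ p_s (a_(n-s) + 1) ≤ a_n
+ 1`. For `S_N = ∑ a_(N-k) q_k` this says `S_N ≤ S_(N+1) + q_(N+1)`. As `S_N → 0`, it follows that
`a_n ≤ S_n ≤ ∑_{k>n} q_k`, which is at most `A(ν) ρ^(n+1) / (1-ρ)` (`renewal_bound`).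

Since `‖T^n g‖² = a_(2n)`, the law `νP^n` is within `D ρ^n` of `π`. Conditioning a chain from `x` on
its first restart leaves the error `∑ p_s D ρ^(t-s) + q_t`, which Abel summation turns into `F(x,t)
ρ^t` (`abs_sub_le_of_regeneration`). -/

section HilbertSpace

/-! ### Symmetric operators with nonnegative spectrum. -/

open scoped InnerProductSpace

variable {E : Type*} [NormedAddCommGroup E] [InnerProductSpace ℝ E]

/-- A nonnegative symmetric operator `S` satisfies `‖S x‖² ≤ (‖S‖ + 1) ⟪S x, x⟫`. -/
theorem norm_apply_sq_le_of_inner_nonneg {S : E →L[ℝ] E}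
    (hsym : ∀ x y, ⟪S x, y⟫_ℝ = ⟪x, S y⟫_ℝ) (hpos : ∀ x, 0 ≤ ⟪S x, x⟫_ℝ) (x : E) :
    ‖S x‖ ^ 2 ≤ (‖S‖ + 1) * ⟪S x, x⟫_ℝ := by
  set k : ℝ := ‖S‖ + 1 with hk
  have hk0 : 0 < k := by positivity
  -- Positivity at `k x - S x` is a form of Cauchy–Schwarz for the form `⟪S x, y⟫`; the `+ 1` keeps
  -- `k` positive when `S = 0`.
  have h := hpos (k • x - S x)
  have h1 : ⟪S (k • x - S x), k • x - S x⟫_ℝ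
      = k ^ 2 * ⟪S x, x⟫_ℝ - 2 * k * ‖S x‖ ^ 2 + ⟪S (S x), S x⟫_ℝ := by
    simp only [map_sub, map_smul, inner_sub_left, inner_sub_right, real_inner_smul_left,
      real_inner_smul_right]
    rw [hsym (S x) x, real_inner_self_eq_norm_sq]
    ring
  have h2 : ⟪S (S x), S x⟫_ℝ ≤ k * ‖S x‖ ^ 2 := by
    calc ⟪S (S x), S x⟫_ℝ ≤ ‖S (S x)‖ * ‖S x‖ := real_inner_le_norm _ _
      _ ≤ (‖S‖ * ‖S x‖) * ‖S x‖ := by gcongr; exact S.le_opNorm _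
      _ ≤ k * ‖S x‖ ^ 2 := by
        rw [hk]; nlinarith [sq_nonneg ‖S x‖]
  rw [h1] at h
  have h3 : 0 ≤ k * (k * ⟪S x, x⟫_ℝ - ‖S x‖ ^ 2) := by nlinarith
  have := nonneg_of_mul_nonneg_right h3 hk0
  linarith

/-- A symmetric operator on a real inner product space with nonnegative spectrum is nonnegative. -/
theorem inner_apply_nonneg_of_spectrum_nonneg {T : E →L[ℝ] E}
    (hsym : ∀ x y, ⟪T x, y⟫_ℝ = ⟪x, T y⟫_ℝ) (hspec : ∀ c ∈ spectrum ℝ T, 0 ≤ c) (x : E) :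
    0 ≤ ⟪T x, x⟫_ℝ := by
  by_contra! hx
  have hx0 : 0 < ‖x‖ := norm_pos_iff.2 (by rintro rfl; simp at hx)
  -- `sSup s` is the infimum of the Rayleigh quotient. If it is negative it lies outside the
  -- spectrum, so `T - c` is invertible and nonnegative, hence bounded below as a form, and `c`
  -- could be increased.
  set s : Set ℝ := {c | ∀ y, c * ‖y‖ ^ 2 ≤ ⟪T y, y⟫_ℝ} with hs
  have hub : ∀ c ∈ s, ∀ y, y ≠ 0 → c ≤ ⟪T y, y⟫_ℝ / ‖y‖ ^ 2 := by
    intro c hc y hy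
    rw [le_div_iff₀ (by positivity)]
    exact hc y
  have hbdd : BddAbove s := ⟨_, fun c hc ↦ hub c hc x (norm_pos_iff.1 hx0)⟩
  have hne : s.Nonempty := by
    refine ⟨-‖T‖, fun y ↦ ?_⟩
    have h1 : -(‖T y‖ * ‖y‖) ≤ ⟪T y, y⟫_ℝ := neg_le_of_abs_le (abs_real_inner_le_norm _ _)
    nlinarith [T.le_opNorm y, norm_nonneg y]
  set c := sSup s with hc
  have hcs : c ∈ s := by
    intro y
    rcases eq_or_ne y 0 with rfl | hy
    · simp
    · rw [← le_div_iff₀ (by positivity)]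
      exact csSup_le hne fun d hd ↦ hub d hd y hy
  have hc0 : c < 0 := by
    have := hcs x
    by_contra! h
    nlinarith [sq_nonneg ‖x‖]
  have hunit : IsUnit (algebraMap ℝ (E →L[ℝ] E) c - T) := by
    by_contra h
    exact absurd (hspec c (spectrum.mem_iff.2 h)) (not_le.2 hc0)
  set S : E →L[ℝ] E := T - algebraMap ℝ (E →L[ℝ] E) c with hS
  have hSy : ∀ y, S y = T y - c • y := fun y ↦ by
    simp [hS, Algebra.algebraMap_eq_smul_one]
  obtain ⟨u, hu⟩ : IsUnit S := by
    rw [hS, ← neg_sub]; exact hunit.neg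
  have hSsym : ∀ y z, ⟪S y, z⟫_ℝ = ⟪y, S z⟫_ℝ := fun y z ↦ by
    rw [hSy, hSy, inner_sub_left, inner_sub_right, hsym, real_inner_smul_left,
      real_inner_smul_right]
  have hSin : ∀ y, ⟪S y, y⟫_ℝ = ⟪T y, y⟫_ℝ - c * ‖y‖ ^ 2 := fun y ↦ by
    rw [hSy, inner_sub_left, real_inner_smul_left, real_inner_self_eq_norm_sq]
  have hSpos : ∀ y, 0 ≤ ⟪S y, y⟫_ℝ := fun y ↦ by
    rw [hSin]; exact sub_nonneg.2 (hcs y)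
  set R : E →L[ℝ] E := ↑u⁻¹
  have hRS : ∀ y, R (S y) = y := fun y ↦ by
    have : R * S = 1 := by rw [← hu]; exact u.inv_mul
    exact congrArg (fun A : E →L[ℝ] E ↦ A y) this
  set k : ℝ := ‖R‖ ^ 2 * (‖S‖ + 1) + 1 with hk
  have hk0 : 0 < k := by positivity
  have hbelow : ∀ y, ‖y‖ ^ 2 ≤ k * ⟪S y, y⟫_ℝ := by
    intro y
    calc ‖y‖ ^ 2 = ‖R (S y)‖ ^ 2 := by rw [hRS]
      _ ≤ (‖R‖ * ‖S y‖) ^ 2 := by gcongr; exact R.le_opNorm _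
      _ = ‖R‖ ^ 2 * ‖S y‖ ^ 2 := by ring
      _ ≤ ‖R‖ ^ 2 * ((‖S‖ + 1) * ⟪S y, y⟫_ℝ) := by
        gcongr; exact norm_apply_sq_le_of_inner_nonneg hSsym hSpos y
      _ ≤ k * ⟪S y, y⟫_ℝ := by rw [hk]; nlinarith [hSpos y]
  have hmem : c + 1 / k ∈ s := by
    intro y
    have := hbelow y
    rw [hSin] at this
    have h2 : 1 / k * ‖y‖ ^ 2 ≤ ⟪T y, y⟫_ℝ - c * ‖y‖ ^ 2 := by
      rw [div_mul_eq_mul_div, one_mul, div_le_iff₀ hk0]; linarith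
    linarith
  have := le_csSup hbdd hmem
  have : 0 < 1 / k := by positivity
  linarith

theorem inner_pow_apply_left {T : E →L[ℝ] E} (hsym : ∀ x y, ⟪T x, y⟫_ℝ = ⟪x, T y⟫_ℝ)
    (n : ℕ) (x y : E) : ⟪(T ^ n) x, y⟫_ℝ = ⟪x, (T ^ n) y⟫_ℝ := by
  induction n generalizing x y with
  | zero => rfl
  | succ n ih =>
    rw [pow_succ]
    change ⟪(T ^ n) (T x), y⟫_ℝ = ⟪x, (T ^ n) (T y)⟫_ℝ
    rw [ih, hsym]
    change ⟪x, (T * T ^ n) y⟫_ℝ = ⟪x, (T ^ n * T) y⟫_ℝ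
    rw [← pow_succ, ← pow_succ']

theorem norm_pow_apply_sq {T : E →L[ℝ] E} (hsym : ∀ x y, ⟪T x, y⟫_ℝ = ⟪x, T y⟫_ℝ)
    (n : ℕ) (x : E) : ‖(T ^ n) x‖ ^ 2 = ⟪x, (T ^ (2 * n)) x⟫_ℝ := by
  rw [← real_inner_self_eq_norm_sq, inner_pow_apply_left hsym, two_mul, pow_add]
  rfl

/-- Even powers give a squared norm; odd powers give the form of `T` at `T ^ k x`. -/
theorem inner_pow_apply_nonneg {T : E →L[ℝ] E} (hsym : ∀ x y, ⟪T x, y⟫_ℝ = ⟪x, T y⟫_ℝ)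
    (hpos : ∀ x, 0 ≤ ⟪T x, x⟫_ℝ) (n : ℕ) (x : E) : 0 ≤ ⟪x, (T ^ n) x⟫_ℝ := by
  obtain ⟨k, rfl | rfl⟩ := n.even_or_odd'
  · rw [← norm_pow_apply_sq hsym]; positivity
  · rw [show 2 * k + 1 = k + (k + 1) by ring, pow_add]
    change 0 ≤ ⟪x, (T ^ k) ((T ^ (k + 1)) x)⟫_ℝ
    rw [← inner_pow_apply_left hsym, real_inner_comm, pow_succ']
    exact hpos _

end HilbertSpace

/-! ### Renewal inequalities with geometric tails. -/

section Renewal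

open Finset Filter Topology

/-- Convolution of a summable sequence with a null sequence tends to zero. -/
theorem tendsto_sum_convolution_zero {a q : ℕ → ℝ} (ha : Tendsto a atTop (𝓝 0))
    (hq : Summable fun n ↦ |q n|) :
    Tendsto (fun N ↦ ∑ k ∈ range (N + 1), a (N - k) * q k) atTop (𝓝 0) := by
  obtain ⟨M, hM⟩ : ∃ M, ∀ n, |a n| ≤ M := by
    obtain ⟨M, hM⟩ := ha.abs.bddAbove_range
    exact ⟨M, fun n ↦ hM ⟨n, rfl⟩⟩
  -- Extend the finite sums by zero to all `k`; boundedness of `a` gives the summable majorant `M *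
  -- |q k|`.
  have h := tendsto_tsum_of_dominated_convergence (𝓕 := atTop)
    (f := fun N k ↦ if k ≤ N then a (N - k) * q k else 0) (g := fun _ : ℕ ↦ (0 : ℝ))
    (bound := fun k ↦ M * |q k|) (hq.mul_left M) (fun k ↦ ?_) (.of_forall fun N k ↦ ?_)
  · rw [tsum_zero] at h
    refine h.congr fun N ↦ ?_
    rw [tsum_eq_sum (s := range (N + 1)) fun k hk ↦ if_neg (by simpa using hk)]
    exact sum_congr rfl fun k hk ↦ if_pos (by simpa [Nat.lt_succ_iff] using hk)
  · have h1 : Tendsto (fun N ↦ a (N - k) * q k) atTop (𝓝 (0 * q k)) :=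
      (ha.comp (tendsto_sub_atTop_nat k)).mul_const _
    rw [zero_mul] at h1
    refine h1.congr' ?_
    filter_upwards [eventually_ge_atTop k] with N hN
    rw [if_pos hN]
  · by_cases hk : k ≤ N
    · simp only [if_pos hk, Real.norm_eq_abs, abs_mul]
      gcongr
      exact hM _
    · simp only [if_neg hk, norm_zero]
      have := (abs_nonneg _).trans (hM 0)
      positivity

/-- Convolving a sequence with the tails `1 - p₀ - ⋯ - pⱼ` and taking differences. -/
theorem sum_mul_tail_succ (a p : ℕ → ℝ) (hp0 : p 0 = 0) (n : ℕ) :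
    ∑ k ∈ range (n + 2), a (n + 1 - k) * (1 - ∑ s ∈ range (k + 1), p s)
      = ∑ k ∈ range (n + 1), a (n - k) * (1 - ∑ s ∈ range (k + 1), p s)
        + (a (n + 1) - ∑ s ∈ range (n + 2), p s * a (n + 1 - s)) := by
  rw [sum_range_succ' _ (n + 1), sum_range_succ' (fun s ↦ p s * _) (n + 1)]
  have : ∀ k, a (n + 1 - (k + 1)) * (1 - ∑ s ∈ range (k + 1 + 1), p s)
      = a (n - k) * (1 - ∑ s ∈ range (k + 1), p s) - p (k + 1) * a (n + 1 - (k + 1)) := by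
    intro k
    rw [sum_range_succ _ (k + 1), Nat.add_sub_add_right]
    ring
  simp only [this, sum_sub_distrib]
  simp [hp0]
  ring

/-- The sequence `a` has nonnegative terms, and `a + 1` is a supersolution of the renewal equation
with increments `p`, whose tails are bounded by `A ρⁿ`. Together with the averaging bound for a
second sequence `w` of weights, this bounds `a` geometrically. -/
theorem renewal_bound {a p w : ℕ → ℝ} {A ρ : ℝ} (hρ0 : 0 ≤ ρ) (hρ1 : ρ < 1)
    (ha : ∀ n, 0 ≤ a n) (hp0 : p 0 = 0)
    (hq0 : ∀ n, ∑ s ∈ range (n + 1), p s ≤ 1)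
    (hq : ∀ n, 1 - ∑ s ∈ range (n + 1), p s ≤ A * ρ ^ n)
    (hren : ∀ n, ∑ s ∈ range (n + 1), p s * (a (n - s) + 1) ≤ a n + 1)
    (hw : ∀ n, 0 ≤ w n)
    (hw1 : Tendsto (fun n ↦ ∑ s ∈ range (n + 1), w s) atTop (𝓝 1))
    (hwa : ∀ n, ∑ s ∈ range (n + 1), w s * (a (n - s) + 1) ≤ 1) (n : ℕ) :
    a n ≤ A * ρ / (1 - ρ) * ρ ^ n := by
  set q : ℕ → ℝ := fun n ↦ 1 - ∑ s ∈ range (n + 1), p s with hqdef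
  have hqn : ∀ n, 0 ≤ q n := fun n ↦ sub_nonneg.2 (hq0 n)
  have hqs : Summable fun n ↦ |q n| := by
    refine Summable.of_nonneg_of_le (fun n ↦ abs_nonneg _) (fun n ↦ ?_)
      ((summable_geometric_of_lt_one hρ0 hρ1).mul_left A)
    rw [abs_of_nonneg (hqn n)]; exact hq n
  -- The weights `w` have total mass one, so the mean of `a + 1` leaves only the tail of `w` as room
  -- for `a`; one positive weight suffices.
  have hlim : Tendsto a atTop (𝓝 0) := by
    obtain ⟨s₀, hs₀⟩ : ∃ s, 0 < w s := by
      by_contra! h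
      have hz : ∀ s, w s = 0 := fun s ↦ le_antisymm (h s) (hw s)
      simp only [hz, sum_const_zero] at hw1
      exact zero_ne_one (tendsto_nhds_unique tendsto_const_nhds hw1)
    have h1 : ∀ n, s₀ ≤ n → a (n - s₀) ≤ (1 - ∑ s ∈ range (n + 1), w s) / w s₀ := by
      intro n hn
      rw [le_div_iff₀ hs₀]
      have h2 := hwa n
      simp only [mul_add, mul_one, sum_add_distrib] at h2
      have h3 : w s₀ * a (n - s₀) ≤ ∑ s ∈ range (n + 1), w s * a (n - s) :=
        single_le_sum (f := fun s ↦ w s * a (n - s)) (fun s _ ↦ mul_nonneg (hw s) (ha _))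
          (mem_range.2 (by omega))
      linarith
    have h2 : Tendsto (fun n ↦ (1 - ∑ s ∈ range (n + s₀ + 1), w s) / w s₀) atTop (𝓝 0) := by
      have := ((hw1.const_sub 1).div_const (w s₀)).comp (tendsto_add_atTop_nat s₀)
      simpa [Function.comp_def] using this
    refine squeeze_zero ha (fun n ↦ ?_) h2
    simpa using h1 (n + s₀) (by omega)
  set S : ℕ → ℝ := fun N ↦ ∑ k ∈ range (N + 1), a (N - k) * q k with hS
  have hS0 : Tendsto S atTop (𝓝 0) := tendsto_sum_convolution_zero hlim hqs
  have hSn : a n ≤ S n := by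
    -- Keep only the term `k = 0`, where `q 0 = 1` because `p 0 = 0`.
    have : a (n - 0) * q 0 ≤ S n := single_le_sum (f := fun k ↦ a (n - k) * q k)
      (fun k _ ↦ mul_nonneg (ha _) (hqn k)) (mem_range.2 (by omega))
    simpa [hqdef, hp0] using this
  have hstep : ∀ N, S N ≤ S (N + 1) + q (N + 1) := by
    intro N
    have h1 : S (N + 1) = S N + (a (N + 1) - ∑ s ∈ range (N + 2), p s * a (N + 1 - s)) :=
      sum_mul_tail_succ a p hp0 N
    have h2 := hren (N + 1)
    simp only [mul_add, mul_one, sum_add_distrib] at h2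
    have h3 : q (N + 1) = 1 - ∑ s ∈ range (N + 1 + 1), p s := rfl
    linarith
  -- The added term is the geometric sum of `A * ρ ^ k` over `n < k ≤ n + j`.
  have hgeo : ∀ j, S n ≤ S (n + j) + A * ρ / (1 - ρ) * (ρ ^ n - ρ ^ (n + j)) := by
    intro j
    induction j with
    | zero => simp
    | succ j ih =>
      have h1 := hstep (n + j)
      have h2 : q (n + j + 1) ≤ A * ρ ^ (n + j + 1) := hq (n + j + 1)
      have h3 : A * ρ / (1 - ρ) * (ρ ^ n - ρ ^ (n + (j + 1)))
          = A * ρ / (1 - ρ) * (ρ ^ n - ρ ^ (n + j)) + A * ρ ^ (n + j + 1) := by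
        have : 1 - ρ ≠ 0 := by linarith
        field_simp
        ring
      rw [h3]
      change S n ≤ S (n + j + 1) + _
      linarith
  have hT : Tendsto (fun j ↦ S (n + j) + A * ρ / (1 - ρ) * (ρ ^ n - ρ ^ (n + j))) atTop
      (𝓝 (0 + A * ρ / (1 - ρ) * (ρ ^ n - 0))) := by
    have e : Tendsto (fun j ↦ n + j) atTop atTop :=
      tendsto_atTop_mono (fun j ↦ Nat.le_add_left j n) tendsto_id
    exact (hS0.comp e).add
      ((((tendsto_pow_atTop_nhds_zero_of_lt_one hρ0 hρ1).comp e).const_sub _).const_mul _)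
  have := ge_of_tendsto' hT hgeo
  rw [zero_add, sub_zero] at this
  exact hSn.trans this

/-- Abel summation for a convolution with a geometric sequence. -/
theorem sum_mul_pow_le_of_tail_le {p : ℕ → ℝ} {A ρ : ℝ} (hρ0 : 0 < ρ) (hρ1 : ρ ≤ 1)
    (hq : ∀ n, 1 - ∑ s ∈ range (n + 1), p s ≤ A * ρ ^ n) (t : ℕ) :
    ∑ s ∈ range (t + 1), p s * ρ ^ (t - s)
      ≤ ρ ^ t + (1 - ρ) / ρ * A * t * ρ ^ t - (1 - ∑ s ∈ range (t + 1), p s) := by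
  induction t with
  | zero => simp
  | succ t ih =>
    rw [sum_range_succ, sum_range_succ _ (t + 1)]
    have h1 : ∑ s ∈ range (t + 1), p s * ρ ^ (t + 1 - s)
        = ρ * ∑ s ∈ range (t + 1), p s * ρ ^ (t - s) := by
      rw [mul_sum]
      refine sum_congr rfl fun s hs ↦ ?_
      rw [Nat.sub_add_comm (Nat.lt_succ_iff.1 (mem_range.1 hs)), pow_succ]
      ring
    rw [h1, Nat.sub_self, pow_zero, mul_one]
    have h2 := mul_le_mul_of_nonneg_left ih hρ0.le
    have h3 := mul_le_mul_of_nonneg_left (hq t) (sub_nonneg.2 hρ1)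
    have h4 : (1 - ρ) / ρ * A * ((t + 1 : ℕ) : ℝ) * ρ ^ (t + 1)
        = ρ * ((1 - ρ) / ρ * A * t * ρ ^ t) + (1 - ρ) * (A * ρ ^ t) := by
      push_cast
      field_simp
      ring
    rw [h4, pow_succ]
    linarith

end Renewal

namespace DriftMinorization

variable {X : Type*} [MeasurableSpace X]

/-! ### The constants `B`, `ρ` and `r`. -/

section Constants

variable {lam K ε : ℝ} {m : ℕ}

theorem constB_eq_sum (hlam1 : lam < 1) :
    constB lam K m = (K - lam) * ∑ i ∈ Finset.range m, lam ^ i + lam ^ m := by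
  have h : lam - 1 ≠ 0 := by linarith
  have h' : 1 - lam ≠ 0 := by linarith
  rw [constB, geom_sum_eq (by linarith)]
  field_simp
  ring

theorem one_le_constB (hlam0 : 0 < lam) (hlam1 : lam < 1) (hK : 1 ≤ K) :
    1 ≤ constB lam K m := by
  have h1 : lam ^ m ≤ 1 := pow_le_one₀ hlam0.le hlam1.le
  have h2 : (1 - lam ^ m) / (1 - lam) * (1 - lam) = 1 - lam ^ m :=
    div_mul_cancel₀ _ (by linarith)
  have h3 : 0 ≤ (1 - lam ^ m) / (1 - lam) := div_nonneg (by linarith) (by linarith)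
  have : (1 - lam ^ m) / (1 - lam) * (1 - lam) ≤ (1 - lam ^ m) / (1 - lam) * (K - lam) :=
    mul_le_mul_of_nonneg_left (by linarith) h3
  rw [constB]
  linarith

/-- The denominator in the definition of `rate` is positive. -/
theorem rate_denominator_pos (hlam0 : 0 < lam) (hlam1 : lam < 1) (hB : 1 ≤ constB lam K m)
    (hm : 1 ≤ m) (hε : ε < 1) :
    0 < -(m : ℝ) * Real.log lam + Real.log (constB lam K m - ε) - Real.log (1 - ε) := by
  have h1 : Real.log lam < 0 := Real.log_neg hlam0 hlam1
  have h2 : Real.log (1 - ε) ≤ Real.log (constB lam K m - ε) :=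
    Real.log_le_log (by linarith) (by linarith)
  have h3 : (1 : ℝ) ≤ m := by exact_mod_cast hm
  nlinarith

theorem lam_le_rate : lam ≤ rate lam K m ε := by
  rw [rate]
  split_ifs
  · exact le_rfl
  · exact le_max_left _ _

theorem rate_lt_one (hlam0 : 0 < lam) (hlam1 : lam < 1) (hB : 1 ≤ constB lam K m)
    (hm : 1 ≤ m) (hε0 : 0 < ε) (hε1 : ε ≤ 1) : rate lam K m ε < 1 := by
  rw [rate]
  split_ifs with h
  · exact hlam1
  · have hε : ε < 1 := lt_of_le_of_ne hε1 h
    refine max_lt hlam1 ((Real.exp_lt_exp.2 ?_).trans_eq Real.exp_zero)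
    refine div_neg_of_neg_of_pos ?_ (rate_denominator_pos hlam0 hlam1 hB hm hε)
    have h1 : Real.log lam < 0 := Real.log_neg hlam0 hlam1
    have h2 : Real.log (1 - ε) < 0 := Real.log_neg (by linarith) (by linarith)
    nlinarith

theorem expo_eq (hlam0 : 0 < lam) (hlam1 : lam < 1) :
    expo lam K m ε = Real.log (rate lam K m ε) / Real.log lam := by
  rw [expo]
  split_ifs with h
  · rw [rate, if_pos h, div_self (Real.log_neg hlam0 hlam1).ne]
  · rfl

theorem expo_pos (hlam0 : 0 < lam) (hlam1 : lam < 1) (hρ : rate lam K m ε < 1) :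
    0 < expo lam K m ε := by
  rw [expo_eq hlam0 hlam1]
  exact div_pos_of_neg_of_neg (Real.log_neg (hlam0.trans_le lam_le_rate) hρ)
    (Real.log_neg hlam0 hlam1)

theorem expo_le_one (hlam0 : 0 < lam) (hlam1 : lam < 1) : expo lam K m ε ≤ 1 := by
  rw [expo_eq hlam0 hlam1, div_le_one_of_neg (Real.log_neg hlam0 hlam1)]
  exact Real.log_le_log hlam0 lam_le_rate

theorem lam_rpow_expo (hlam0 : 0 < lam) (hlam1 : lam < 1) :
    lam ^ expo lam K m ε = rate lam K m ε := by
  rw [Real.rpow_def_of_pos hlam0, expo_eq hlam0 hlam1,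
    mul_div_cancel₀ _ (Real.log_neg hlam0 hlam1).ne,
    Real.exp_log (hlam0.trans_le lam_le_rate)]

/-- This is the inequality for which `ρ` is designed. After taking logarithms and substituting `log
ρ = r log λ` it is linear in `r`, and the second entry of the maximum is its equality case. -/
theorem rpow_mul_rpow_le_rate_pow (hlam0 : 0 < lam) (hlam1 : lam < 1)
    (hB : 1 ≤ constB lam K m) (hm : 1 ≤ m) (hε : ε < 1) :
    (constB lam K m - ε) ^ expo lam K m ε * (1 - ε) ^ (1 - expo lam K m ε)
      ≤ rate lam K m ε ^ m := by
  have hl : Real.log lam < 0 := Real.log_neg hlam0 hlam1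
  have hden := rate_denominator_pos hlam0 hlam1 hB hm hε
  have h1 : 0 < 1 - ε := by linarith
  have hBε : 0 < constB lam K m - ε := by linarith
  have hρ0 : 0 < rate lam K m ε := hlam0.trans_le lam_le_rate
  have hr := expo_eq (K := K) (m := m) (ε := ε) hlam0 hlam1
  rw [← Real.log_le_log_iff (by positivity) (by positivity),
    Real.log_mul (by positivity) (by positivity), Real.log_rpow hBε, Real.log_rpow h1,
    Real.log_pow]
  have hlogρ : Real.log (rate lam K m ε) = expo lam K m ε * Real.log lam := by
    rw [hr, div_mul_cancel₀ _ hl.ne]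
  have hle : -Real.log (1 - ε) * Real.log lam /
      (-(m : ℝ) * Real.log lam + Real.log (constB lam K m - ε) - Real.log (1 - ε))
      ≤ expo lam K m ε * Real.log lam := by
    rw [← hlogρ, Real.le_log_iff_exp_le hρ0]
    conv_rhs => rw [rate, if_neg hε.ne]
    exact le_max_right _ _
  rw [div_le_iff₀ hden] at hle
  rw [hlogρ]
  have h2 : expo lam K m ε *
      (-(m : ℝ) * Real.log lam + Real.log (constB lam K m - ε) - Real.log (1 - ε))
      ≤ -Real.log (1 - ε) := by
    by_contra! h
    nlinarith [mul_lt_mul_of_neg_right h hl]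
  linarith

end Constants

instance isMarkovKernel_pow (P : Kernel X X) [IsMarkovKernel P] (k : ℕ) :
    IsMarkovKernel (P ^ k) := by
  induction k with
  | zero => exact inferInstanceAs (IsMarkovKernel Kernel.id)
  | succ k ih =>
    rw [pow_succ]
    exact inferInstanceAs (IsMarkovKernel ((P ^ k) ∘ₖ P))

/-! ### Regeneration times and their tails. -/

section Regeneration

open Finset

open Classical in
/-- The residual kernel `P^m - e ν` on a set where `P^m ≥ e ν`. -/
theorem exists_residual_kernel (κ : Kernel X X) [IsFiniteKernel κ] {C : Set X}
    (hC : MeasurableSet C) (μ : Measure X) [IsFiniteMeasure μ] (h : ∀ x ∈ C, μ ≤ κ x) :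
    ∃ N : Kernel X X, ∀ x ∈ C, N x + μ = κ x := by
  refine ⟨⟨fun x ↦ if x ∈ C then κ x - μ else 0, ?_⟩, fun x hx ↦ ?_⟩
  · refine Measure.measurable_of_measurable_coe _ fun S hS ↦ ?_
    have e : (fun x ↦ (if x ∈ C then κ x - μ else 0) S)
        = fun x ↦ if x ∈ C then κ x S - μ S else 0 := by
      funext x
      split_ifs with hx
      · exact Measure.sub_apply hS (h x hx)
      · rfl
    rw [e]
    exact Measurable.ite hC ((Kernel.measurable_coe κ hS).sub measurable_const) measurable_const
  · change (if x ∈ C then κ x - μ else 0) + μ = κ x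
    rw [if_pos hx]
    exact Measure.sub_add_cancel_of_le (h x hx)

open Classical in
/-- The law of the first regeneration time of the chain started from `x`: off `C` the chain makes
one step with `P`; on `C` it regenerates after `m` steps with probability `e`, and otherwise makes
`m` steps with the residual kernel `N`. -/
noncomputable def regenProb (P N : Kernel X X) (C : Set X) (m : ℕ) (e : ℝ≥0∞) :
    ℕ → X → ℝ≥0∞
  | t => fun x ↦
    if x ∈ C then
      if _h : 1 ≤ m ∧ m ≤ t then
        (if t = m then e else 0) + ∫⁻ y, regenProb P N C m e (t - m) y ∂(N x)
      else 0
    else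
      if _h : 1 ≤ t then ∫⁻ y, regenProb P N C m e (t - 1) y ∂(P x) else 0
termination_by t => t

variable {P N : Kernel X X} {C : Set X} {m : ℕ} {e : ℝ≥0∞}

theorem regenProb_of_mem_lt {x : X} (hx : x ∈ C) {t : ℕ} (ht : t < m) :
    regenProb P N C m e t x = 0 := by
  rw [regenProb]
  beta_reduce
  rw [if_pos hx, dif_neg (by omega)]

theorem regenProb_of_mem_add {x : X} (hx : x ∈ C) (hm : 1 ≤ m) (t : ℕ) :
    regenProb P N C m e (m + t) x
      = (if t = 0 then e else 0) + ∫⁻ y, regenProb P N C m e t y ∂(N x) := by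
  rw [regenProb]
  beta_reduce
  rw [if_pos hx, dif_pos ⟨hm, by omega⟩]
  simp

theorem regenProb_of_notMem_succ {x : X} (hx : x ∉ C) (t : ℕ) :
    regenProb P N C m e (t + 1) x = ∫⁻ y, regenProb P N C m e t y ∂(P x) := by
  rw [regenProb]
  beta_reduce
  rw [if_neg hx, dif_pos (by omega)]
  simp

theorem regenProb_zero (hm : 1 ≤ m) (x : X) : regenProb P N C m e 0 x = 0 := by
  by_cases hx : x ∈ C
  · exact regenProb_of_mem_lt hx hm
  · rw [regenProb]
    beta_reduce
    rw [if_neg hx, dif_neg (by omega)]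

theorem measurable_regenProb (hC : MeasurableSet C) (t : ℕ) :
    Measurable (regenProb P N C m e t) := by
  induction t using Nat.strong_induction_on with
  | _ t ih =>
    rw [regenProb]
    refine Measurable.ite hC ?_ ?_
    · split_ifs with h h'
      · exact (measurable_const).add (ih _ (by omega)).lintegral_kernel
      · exact (measurable_const).add (ih _ (by omega)).lintegral_kernel
      · exact measurable_const
    · split_ifs with h
      · exact (ih _ (by omega)).lintegral_kernel
      · exact measurable_const

/-- First-step analysis with free weights `b`: taking `b k = (νP^k)(S)` describes the regenerated
part of the chain, and `b = 1` the distribution function of the regeneration time. -/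
theorem sum_regenProb_of_notMem (hC : MeasurableSet C) (hm : 1 ≤ m) {x : X} (hx : x ∉ C)
    (b : ℕ → ℝ≥0∞) (t : ℕ) :
    ∑ s ∈ range (t + 2), regenProb P N C m e s x * b (t + 1 - s)
      = ∫⁻ y, ∑ s ∈ range (t + 1), regenProb P N C m e s y * b (t - s) ∂(P x) := by
  rw [sum_range_succ', regenProb_zero hm, zero_mul, add_zero,
    lintegral_finsetSum _ fun s _ ↦ (measurable_regenProb hC s).mul_const _]
  refine sum_congr rfl fun s _ ↦ ?_
  rw [regenProb_of_notMem_succ hx, lintegral_mul_const _ (measurable_regenProb hC s),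
    Nat.add_sub_add_right]

theorem sum_regenProb_of_mem_lt {x : X} (hx : x ∈ C) {t : ℕ} (ht : t < m) (b : ℕ → ℝ≥0∞) :
    ∑ s ∈ range (t + 1), regenProb P N C m e s x * b (t - s) = 0 :=
  sum_eq_zero fun s hs ↦ by
    rw [regenProb_of_mem_lt hx (by have := mem_range.1 hs; omega), zero_mul]

theorem sum_regenProb_of_mem_add (hC : MeasurableSet C) (hm : 1 ≤ m) {x : X} (hx : x ∈ C)
    (b : ℕ → ℝ≥0∞) (t : ℕ) :
    ∑ s ∈ range (m + t + 1), regenProb P N C m e s x * b (m + t - s)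
      = e * b t
        + ∫⁻ y, ∑ s ∈ range (t + 1), regenProb P N C m e s y * b (t - s) ∂(N x) := by
  rw [add_assoc, sum_range_add, sum_eq_zero fun s hs ↦ by
    rw [regenProb_of_mem_lt hx (mem_range.1 hs), zero_mul], zero_add,
    lintegral_finsetSum _ fun s _ ↦ (measurable_regenProb hC s).mul_const _]
  simp only [regenProb_of_mem_add hx hm, add_mul, sum_add_distrib, Nat.add_sub_add_left,
    lintegral_mul_const _ (measurable_regenProb hC _)]
  congr 1
  rw [sum_eq_single 0]
  · simp
  · intro s _ hs
    simp [hs]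
  · simp

/-- The part of the chain that has regenerated by time `t`. -/
theorem sum_regenProb_mul_le [IsMarkovKernel P] {ν : Measure X} (hC : MeasurableSet C) (hm : 1 ≤ m)
    (hN : ∀ x ∈ C, N x + e • ν = (P ^ m) x) {S : Set X} (hS : MeasurableSet S) (t : ℕ) (x : X) :
    ∑ s ∈ range (t + 1), regenProb P N C m e s x * ((P ^ (t - s)) ∘ₘ ν) S ≤ (P ^ t) x S := by
  induction t using Nat.strong_induction_on generalizing x with
  | _ t ih =>
    by_cases hx : x ∈ C
    · rcases lt_or_ge t m with ht | ht
      · rw [sum_regenProb_of_mem_lt hx ht fun k ↦ ((P ^ k) ∘ₘ ν) S]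
        exact zero_le
      · obtain ⟨j, rfl⟩ := Nat.exists_eq_add_of_le ht
        rw [sum_regenProb_of_mem_add hC hm hx fun k ↦ ((P ^ k) ∘ₘ ν) S,
          Kernel.pow_add_apply_eq_lintegral P m j x hS, ← hN x hx, lintegral_add_measure,
          lintegral_smul_measure, Measure.bind_apply hS (Kernel.aemeasurable _), add_comm,
          smul_eq_mul]
        gcongr with y
        exact ih j (by omega) y
    · cases t with
      | zero => simp [regenProb_zero hm]
      | succ t =>
        rw [sum_regenProb_of_notMem hC hm hx fun k ↦ ((P ^ k) ∘ₘ ν) S,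
          show (P ^ (t + 1)) x S = ∫⁻ y, (P ^ t) y S ∂(P x) by
            rw [add_comm, Kernel.pow_add_apply_eq_lintegral P 1 t x hS, pow_one]]
        gcongr with y
        exact ih t (by omega) y

/-- The tail of the regeneration time is bounded by a drift function. -/
theorem one_le_sum_regenProb_add [IsMarkovKernel P] {ν : Measure X} [IsProbabilityMeasure ν]
    (hC : MeasurableSet C) (hm : 1 ≤ m)
    (hN : ∀ x ∈ C, N x + e • ν = (P ^ m) x) {W : X → ℝ≥0∞} (hW : Measurable W)
    (hW1 : ∀ x, 1 ≤ W x) {ρ c : ℝ≥0∞} (hc : ∀ t < m, 1 ≤ c * ρ ^ t)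
    (hoff : ∀ x ∉ C, ∫⁻ y, W y ∂(P x) ≤ ρ * W x)
    (hon : ∀ x ∈ C, ∫⁻ y, W y ∂(N x) ≤ ρ ^ m) (t : ℕ) (x : X) :
    1 ≤ ∑ s ∈ range (t + 1), regenProb P N C m e s x + c * ρ ^ t * W x := by
  have hmeas : ∀ t, Measurable fun y ↦ ∑ s ∈ range (t + 1), regenProb P N C m e s y :=
    fun t ↦ Finset.measurable_fun_sum _ fun s _ ↦ measurable_regenProb hC s
  induction t using Nat.strong_induction_on generalizing x with
  | _ t ih =>
    by_cases hx : x ∈ C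
    · rcases lt_or_ge t m with ht | ht
      -- No regeneration is possible before time `m`; the constant `c` covers these times.
      · exact (one_le_mul (hc t ht) (hW1 x)).trans le_add_self
      · obtain ⟨j, rfl⟩ := Nat.exists_eq_add_of_le ht
        have h1 := sum_regenProb_of_mem_add (P := P) (N := N) (e := e) hC hm hx (fun _ ↦ 1) j
        simp only [mul_one] at h1
        have h2 : (1 : ℝ≥0∞) = N x Set.univ + e := by
          have := congrArg (fun μ : Measure X ↦ μ Set.univ) (hN x hx)
          simpa using this.symm
        have h3 : N x Set.univ ≤ ∫⁻ y, (∑ s ∈ range (j + 1), regenProb P N C m e s y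
            + c * ρ ^ j * W y) ∂(N x) := by
          rw [← lintegral_one]
          exact lintegral_mono fun y ↦ ih j (by omega) y
        rw [lintegral_add_left (hmeas j), lintegral_const_mul _ hW] at h3
        calc (1 : ℝ≥0∞) = N x Set.univ + e := h2
          _ ≤ (∫⁻ y, ∑ s ∈ range (j + 1), regenProb P N C m e s y ∂(N x)
              + c * ρ ^ j * ρ ^ m) + e := by
            refine add_le_add (h3.trans ?_) le_rfl
            gcongr
            exact hon x hx
          _ ≤ (∫⁻ y, ∑ s ∈ range (j + 1), regenProb P N C m e s y ∂(N x)
              + c * ρ ^ (m + j) * W x) + e := by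
            -- The bound on `C` does not involve `W x`; that factor is restored using `1 ≤ W x`.
            rw [mul_assoc, ← pow_add, add_comm j m]
            exact add_le_add_left (add_le_add_right (le_mul_of_one_le_right' (hW1 x)) _) _
          _ = _ := by rw [h1]; ring
    · cases t with
      | zero => exact (one_le_mul (hc 0 hm) (hW1 x)).trans le_add_self
      | succ t =>
        have h1 := sum_regenProb_of_notMem (P := P) (N := N) (e := e) hC hm hx (fun _ ↦ 1) t
        simp only [mul_one] at h1
        have h3 : P x Set.univ ≤ ∫⁻ y, (∑ s ∈ range (t + 1), regenProb P N C m e s y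
            + c * ρ ^ t * W y) ∂(P x) := by
          rw [← lintegral_one]
          exact lintegral_mono fun y ↦ ih t (by omega) y
        rw [lintegral_add_left (hmeas t), lintegral_const_mul _ hW, measure_univ] at h3
        rw [h1]
        refine h3.trans ?_
        rw [pow_succ, ← mul_assoc, mul_assoc (c * ρ ^ t)]
        gcongr
        exact hoff x hx

end Regeneration

/-! ### Consequences of the drift condition. -/

section Drift

/-- Hölder's inequality for concave powers. -/
theorem lintegral_rpow_le_rpow_lintegral (μ : Measure X) {v : X → ℝ≥0∞}
    (hv : AEMeasurable v μ) {r : ℝ} (hr0 : 0 ≤ r) (hr1 : r ≤ 1) :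
    ∫⁻ y, v y ^ r ∂μ ≤ (∫⁻ y, v y ∂μ) ^ r * μ Set.univ ^ (1 - r) := by
  have := ENNReal.lintegral_mul_norm_pow_le (μ := μ) hv (aemeasurable_const (b := (1 : ℝ≥0∞)))
    hr0 (sub_nonneg.2 hr1) (by ring)
  simpa using this

variable {P : Kernel X X} [IsMarkovKernel P] {C : Set X} {V : X → ℝ} {lam K : ℝ}

/-- With `C` empty the drift iterates to `P^k V ≤ λ^k V`, which tends to zero, although `V ≥ 1`. -/
theorem IsDriftFunction.nonempty [Nonempty X] (h : IsDriftFunction P C V lam K) (hlam : 0 < lam) :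
    C.Nonempty := by
  by_contra! hC
  obtain ⟨x⟩ := ‹Nonempty X›
  have hoff : ∀ x, ∫⁻ y, ENNReal.ofReal (V y) ∂(P x) ≤ ENNReal.ofReal lam * ENNReal.ofReal (V x) :=
    fun x ↦ by rw [← ENNReal.ofReal_mul hlam.le]; exact h.drift_off x (by simp [hC])
  have hpow : ∀ k, ∫⁻ y, ENNReal.ofReal (V y) ∂((P ^ k) x)
      ≤ ENNReal.ofReal lam ^ k * ENNReal.ofReal (V x) := by
    intro k
    induction k with
    | zero =>
      change ∫⁻ y, ENNReal.ofReal (V y) ∂(Kernel.id x) ≤ _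
      rw [Kernel.id_apply, lintegral_dirac' _ h.measurable.ennreal_ofReal]
      simp
    | succ k ih =>
      rw [pow_succ']
      change ∫⁻ y, ENNReal.ofReal (V y) ∂((P ∘ₖ (P ^ k)) x) ≤ _
      rw [Kernel.lintegral_comp _ _ _ h.measurable.ennreal_ofReal]
      refine (lintegral_mono hoff).trans ?_
      rw [lintegral_const_mul _ h.measurable.ennreal_ofReal, pow_succ', mul_assoc]
      gcongr
  have hone : ∀ k, 1 ≤ ENNReal.ofReal lam ^ k * ENNReal.ofReal (V x) := by
    intro k
    refine le_trans ?_ (hpow k)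
    calc (1 : ℝ≥0∞) = ∫⁻ _, 1 ∂((P ^ k) x) := by simp
      _ ≤ _ := lintegral_mono fun y ↦ by simpa using h.one_le y
  have hlim := ENNReal.Tendsto.mul_const (b := ENNReal.ofReal (V x))
    (ENNReal.tendsto_pow_atTop_nhds_zero_of_lt_one (ENNReal.ofReal_lt_one.2 h.lam_lt_one))
    (Or.inr ENNReal.ofReal_ne_top)
  rw [zero_mul] at hlim
  exact absurd (ge_of_tendsto' hlim hone) (by simp)

theorem IsDriftFunction.one_le_bound [Nonempty X] (h : IsDriftFunction P C V lam K)
    (hlam : 0 < lam) : 1 ≤ K := by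
  obtain ⟨x, hx⟩ := h.nonempty hlam
  rw [← ENNReal.one_le_ofReal]
  refine le_trans ?_ (h.drift_on x hx)
  calc (1 : ℝ≥0∞) = ∫⁻ _, 1 ∂(P x) := by simp
    _ ≤ _ := lintegral_mono fun y ↦ by simpa using h.one_le y

theorem IsDriftFunction.lintegral_le [Nonempty X] (h : IsDriftFunction P C V lam K)
    (hlam : 0 < lam) (x : X) :
    ∫⁻ y, ENNReal.ofReal (V y) ∂(P x)
      ≤ ENNReal.ofReal lam * ENNReal.ofReal (V x) + ENNReal.ofReal (K - lam) := by
  have hK := h.one_le_bound hlam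
  have hl := h.lam_lt_one
  by_cases hx : x ∈ C
  · refine (h.drift_on x hx).trans ?_
    rw [← ENNReal.ofReal_mul hlam.le, ← ENNReal.ofReal_add
      (mul_nonneg hlam.le (zero_le_one.trans (h.one_le x))) (by linarith)]
    exact ENNReal.ofReal_le_ofReal (by nlinarith [h.one_le x])
  · refine (h.drift_off x hx).trans ?_
    rw [ENNReal.ofReal_mul hlam.le]
    exact le_self_add

/-- The first step leaves `C` with bound `K`; each further step applies `PV ≤ λV + (K - λ)`, and `B`
solves the resulting recursion. -/
theorem IsDriftFunction.lintegral_pow_le [Nonempty X] (h : IsDriftFunction P C V lam K)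
    (hlam : 0 < lam) {m : ℕ} (hm : 1 ≤ m) {x : X} (hx : x ∈ C) :
    ∫⁻ y, ENNReal.ofReal (V y) ∂((P ^ m) x) ≤ ENNReal.ofReal (constB lam K m) := by
  have hK := h.one_le_bound hlam
  have hl := h.lam_lt_one
  rw [constB_eq_sum hl]
  induction m, hm using Nat.le_induction with
  | base =>
    rw [pow_one]
    refine (h.drift_on x hx).trans (le_of_eq ?_)
    congr 1
    simp
  | succ m hm ih =>
    rw [pow_succ']
    change ∫⁻ y, ENNReal.ofReal (V y) ∂((P ∘ₖ (P ^ m)) x) ≤ _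
    rw [Kernel.lintegral_comp _ _ _ h.measurable.ennreal_ofReal]
    refine (lintegral_mono (h.lintegral_le hlam)).trans ?_
    rw [lintegral_add_right _ measurable_const, lintegral_const_mul _ h.measurable.ennreal_ofReal,
      lintegral_const, measure_univ, mul_one]
    refine (add_le_add_left (mul_le_mul_right ih _) _).trans (le_of_eq ?_)
    have h0 : 0 ≤ (K - lam) * ∑ i ∈ Finset.range m, lam ^ i + lam ^ m := by
      have : 0 ≤ K - lam := by linarith
      positivity
    rw [← ENNReal.ofReal_mul hlam.le, ← ENNReal.ofReal_add (mul_nonneg hlam.le h0) (by linarith)]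
    congr 1
    rw [Finset.sum_range_succ', pow_succ']
    simp only [pow_succ', ← Finset.mul_sum, pow_zero]
    ring

end Drift

/-! ### The transition operator on `L²(π)` and correlations. -/

section Operator

open scoped InnerProductSpace NNReal

theorem integral_measure_comp {Y : Type*} [MeasurableSpace Y] (μ : Measure X) [SFinite μ]
    (κ : Kernel X Y) [IsSFiniteKernel κ] {h : Y → ℝ} (hh : Integrable h (κ ∘ₘ μ)) :
    ∫ y, h y ∂(κ ∘ₘ μ) = ∫ x, ∫ y, h y ∂(κ x) ∂μ := by
  have e : (κ ∘ₖ Kernel.const Unit μ) () = κ ∘ₘ μ := by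
    rw [Kernel.comp_const, Kernel.const_apply]
  have := Kernel.integral_comp (κ := Kernel.const Unit μ) (η := κ) (a := ()) (f := h)
    (by rw [e]; exact hh)
  rwa [e, Kernel.const_apply] at this

theorem integrable_of_bounded {μ : Measure X} [IsFiniteMeasure μ] {h : X → ℝ}
    (hm : Measurable h) {M : ℝ} (hM : ∀ x, |h x| ≤ M) : Integrable h μ :=
  Integrable.of_bound hm.aestronglyMeasurable M (.of_forall hM)

theorem memLp_of_bounded {μ : Measure X} [IsFiniteMeasure μ] {h : X → ℝ}
    (hm : Measurable h) {M : ℝ} (hM : ∀ x, |h x| ≤ M) : MemLp h 2 μ :=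
  MemLp.of_bound hm.aestronglyMeasurable M (.of_forall hM)

/-- A measure dominated by a multiple of `π` has a bounded density. -/
theorem exists_bounded_density {ν π : Measure X} [IsFiniteMeasure ν] [IsFiniteMeasure π] {k : ℝ≥0}
    (h : ν ≤ (k : ℝ≥0∞) • π) :
    ∃ f : X → ℝ, Measurable f ∧ (∀ x, 0 ≤ f x) ∧ (∀ x, f x ≤ k) ∧
      ∀ g : X → ℝ, ∫ x, g x ∂ν = ∫ x, f x * g x ∂π := by
  have hac : ν ≪ π := (Measure.absolutelyContinuous_of_le h).trans Measure.smul_absolutelyContinuous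
  have hle : ν.rnDeriv π ≤ᵐ[π] fun _ ↦ (k : ℝ≥0∞) := by
    refine ae_le_of_forall_setLIntegral_le_of_sigmaFinite (Measure.measurable_rnDeriv _ _)
      fun s hs _ ↦ ?_
    rw [setLIntegral_const]
    refine (Measure.setLIntegral_rnDeriv_le s).trans ?_
    simpa using h s
  -- Truncation at `k` makes the bound hold everywhere and changes the density only on a `π`-null
  -- set.
  refine ⟨fun x ↦ min (ν.rnDeriv π x).toReal k,
    (Measure.measurable_rnDeriv _ _).ennreal_toReal.min measurable_const,
    fun x ↦ le_min ENNReal.toReal_nonneg k.coe_nonneg, fun x ↦ min_le_right _ _, fun g ↦ ?_⟩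
  rw [← integral_rnDeriv_smul hac]
  refine integral_congr_ae ?_
  filter_upwards [hle] with x hx
  rw [min_eq_left, smul_eq_mul]
  exact ENNReal.toReal_le_coe_of_le_coe hx

theorem invariant_pow {P : Kernel X X} {π : Measure X} (hπ : P.Invariant π) (n : ℕ) :
    (P ^ n).Invariant π := by
  induction n with
  | zero => exact Measure.id_comp
  | succ n ih =>
    rw [pow_succ]
    exact ih.comp hπ

theorem inner_toLp_eq_integral {π : Measure X} {g h : X → ℝ} (hg : MemLp g 2 π)
    (hh : MemLp h 2 π) : ⟪hg.toLp g, hh.toLp h⟫_ℝ = ∫ x, g x * h x ∂π := by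
  rw [L2.inner_def]
  refine integral_congr_ae ?_
  filter_upwards [hg.coeFn_toLp, hh.coeFn_toLp] with x h1 h2
  rw [h1, h2, real_inner_comm]
  rfl

variable {P : Kernel X X} [IsMarkovKernel P] {π : Measure X} [IsProbabilityMeasure π]

theorem map_swap_compProd (hrev : P.IsReversible π) : (π ⊗ₘ P).map Prod.swap = π ⊗ₘ P := by
  refine Measure.ext_prod fun {s t} hs ht ↦ ?_
  rw [Measure.map_apply measurable_swap (hs.prod ht), Set.preimage_swap_prod,
    Measure.compProd_apply_prod ht hs, Measure.compProd_apply_prod hs ht]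
  exact hrev ht hs

theorem inner_transitionOperator (hπ : P.Invariant π) (u v : Lp ℝ 2 π) :
    ⟪u, transitionOperator P π hπ v⟫_ℝ = ∫ z, u z.1 * v z.2 ∂(π ⊗ₘ P) := by
  have h1 : MeasurePreserving Prod.fst (π ⊗ₘ P) π := ⟨measurable_fst, Measure.fst_compProd _ _⟩
  have h2 : MeasurePreserving Prod.snd (π ⊗ₘ P) π :=
    ⟨measurable_snd, (Measure.snd_compProd _ _).trans hπ⟩
  have hint : Integrable (fun z : X × X ↦ u z.1 * v z.2) (π ⊗ₘ P) :=
    ((Lp.memLp u).comp_measurePreserving h1).integrable_mul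
      ((Lp.memLp v).comp_measurePreserving h2)
  rw [Measure.integral_compProd hint, L2.inner_def]
  refine integral_congr_ae ?_
  filter_upwards [transitionOperator_ae_eq P π hπ v] with x hx
  rw [hx, integral_const_mul, real_inner_comm]
  rfl

/-- Both sides are integrals against `π ⊗ₘ P`, which reversibility makes invariant under the swap.
-/
theorem transitionOperator_symmetric (hrev : P.IsReversible π) (u v : Lp ℝ 2 π) :
    ⟪transitionOperator P π hrev.invariant u, v⟫_ℝ
      = ⟪u, transitionOperator P π hrev.invariant v⟫_ℝ := by
  rw [real_inner_comm, inner_transitionOperator, inner_transitionOperator]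
  conv_lhs => rw [← map_swap_compProd hrev]
  refine (MeasurableEquiv.prodComm.measurableEmbedding.integral_map _).trans ?_
  exact integral_congr_ae (.of_forall fun z ↦ mul_comm _ _)

theorem transitionOperator_pow_ae_eq (hπ : P.Invariant π) {h : X → ℝ} (hm : Measurable h)
    {M : ℝ} (hM : ∀ x, |h x| ≤ M) (n : ℕ) :
    (transitionOperator P π hπ ^ n) ((memLp_of_bounded hm hM).toLp h)
      =ᵐ[π] fun x ↦ ∫ y, h y ∂((P ^ n) x) := by
  induction n with
  | zero =>
    refine (MemLp.coeFn_toLp (memLp_of_bounded hm hM)).trans (.of_forall fun x ↦ ?_)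
    change h x = ∫ y, h y ∂(Kernel.id x)
    rw [Kernel.id_apply, integral_dirac' _ _ hm.stronglyMeasurable]
  | succ n ih =>
    rw [pow_succ']
    refine (transitionOperator_ae_eq P π hπ _).trans ((kernel_integral_congr hπ ih).trans
      (.of_forall fun x ↦ ?_))
    rw [pow_succ]
    exact (Kernel.integral_comp (κ := P) (η := P ^ n) (integrable_of_bounded hm hM)).symm

/-- Integration against `ν Pⁿ`, where `ν` has density `f`, as an inner product. -/
theorem integral_comp_eq_inner (hπ : P.Invariant π) {ν : Measure X} [IsProbabilityMeasure ν]
    {f : X → ℝ} (hf : Measurable f) {k : ℝ} (hk : ∀ x, |f x| ≤ k)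
    (hdens : ∀ g : X → ℝ, ∫ x, g x ∂ν = ∫ x, f x * g x ∂π)
    {h : X → ℝ} (hm : Measurable h) {M : ℝ} (hM : ∀ x, |h x| ≤ M) (n : ℕ) :
    ∫ x, h x ∂((P ^ n) ∘ₘ ν)
      = ⟪(memLp_of_bounded hf hk).toLp f,
          (transitionOperator P π hπ ^ n) ((memLp_of_bounded hm hM).toLp h)⟫_ℝ := by
  rw [integral_measure_comp _ _ (integrable_of_bounded hm hM), hdens, L2.inner_def]
  refine integral_congr_ae ?_
  filter_upwards [transitionOperator_pow_ae_eq hπ hm hM n,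
    (memLp_of_bounded (μ := π) hf hk).coeFn_toLp] with x h1 h2
  rw [h1, h2, real_inner_comm]
  rfl

/-- For a reversible chain with nonnegative eigenvalues and an initial law `ν` with bounded
density `f`, the correlations `∫ f d(νPⁿ) - 1` are nonnegative and control the distance of `νPⁿ`
to equilibrium. -/
theorem correlation_bounds (hrev : P.IsReversible π) (hspec : HasNonnegativeEigenvalues P π hrev)
    {ν : Measure X} [IsProbabilityMeasure ν] {f : X → ℝ} (hf : Measurable f) {k : ℝ}
    (hk : ∀ x, |f x| ≤ k) (hdens : ∀ g : X → ℝ, ∫ x, g x ∂ν = ∫ x, f x * g x ∂π) (n : ℕ) :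
    0 ≤ (∫ x, f x ∂((P ^ n) ∘ₘ ν)) - 1 ∧
      ∀ S, MeasurableSet S → |((P ^ n) ∘ₘ ν).real S - π.real S|
        ≤ 1 / 2 * √((∫ x, f x ∂((P ^ (2 * n)) ∘ₘ ν)) - 1) := by
  have hπ := hrev.invariant
  set T := transitionOperator P π hπ
  have hsym : ∀ u v, ⟪T u, v⟫_ℝ = ⟪u, T v⟫_ℝ := transitionOperator_symmetric hrev
  have hpos : ∀ u, 0 ≤ ⟪T u, u⟫_ℝ :=
    inner_apply_nonneg_of_spectrum_nonneg hsym fun c hc ↦ (hspec hc).1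
  have hone_le : ∀ _ : X, |(1 : ℝ)| ≤ 1 := fun _ ↦ by simp
  have hm1 : Measurable fun _ : X ↦ (1 : ℝ) := measurable_const
  set u := (memLp_of_bounded (μ := π) hf hk).toLp f with hu
  set one := (memLp_of_bounded (μ := π) hm1 hone_le).toLp fun _ ↦ (1 : ℝ) with hone
  have hTone : ∀ n, (T ^ n) one = one := by
    intro n
    refine Lp.ext ((transitionOperator_pow_ae_eq hπ hm1 hone_le n).trans ?_)
    refine Filter.EventuallyEq.trans (.of_forall fun x ↦ ?_) (MemLp.coeFn_toLp _).symm
    simp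
  have h11 : ⟪one, one⟫_ℝ = 1 := by
    rw [hone, inner_toLp_eq_integral]; simp
  have hu1 : ⟪u, one⟫_ℝ = 1 := by
    rw [hu, hone, inner_toLp_eq_integral, ← hdens]; simp
  set g := u - one with hg
  have hTg : ∀ n, (T ^ n) u = (T ^ n) g + one := by
    intro n
    rw [hg, map_sub, hTone]; abel
  have hg1 : ⟪g, one⟫_ℝ = 0 := by rw [hg, inner_sub_left, hu1, h11, sub_self]
  have hTg1 : ∀ n, ⟪(T ^ n) g, one⟫_ℝ = 0 := by
    intro n
    rw [inner_pow_apply_left hsym, hTone, hg1]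
  have hcorr : ∀ n : ℕ, (∫ x, f x ∂((P ^ n) ∘ₘ ν)) - 1 = ⟪g, (T ^ n) g⟫_ℝ := by
    intro n
    rw [integral_comp_eq_inner hπ hf hk hdens hf hk]
    change ⟪u, (T ^ n) u⟫_ℝ - 1 = _
    rw [hTg, show u = g + one by rw [hg]; abel, inner_add_left, inner_add_right, inner_add_right,
      hg1, h11, real_inner_comm _ one, hTg1]
    ring
  refine ⟨by rw [hcorr]; exact inner_pow_apply_nonneg hsym hpos n g, fun S hS ↦ ?_⟩
  have hmS : Measurable (S.indicator fun _ ↦ (1 : ℝ)) := measurable_const.indicator hS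
  have hSle : ∀ x, |S.indicator (fun _ ↦ (1 : ℝ)) x| ≤ 1 := fun x ↦ by
    by_cases hx : x ∈ S <;> simp [hx]
  set s := (memLp_of_bounded (μ := π) hmS hSle).toLp _ with hs
  have hs1 : ⟪one, s⟫_ℝ = π.real S := by
    rw [hone, hs, inner_toLp_eq_integral]
    simp [integral_indicator hS]
  have hss : ⟪s, s⟫_ℝ = π.real S := by
    rw [hs, inner_toLp_eq_integral]
    have : (fun x ↦ S.indicator (fun _ ↦ (1 : ℝ)) x * S.indicator (fun _ ↦ (1 : ℝ)) x)
        = S.indicator fun _ ↦ (1 : ℝ) := by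
      funext x
      by_cases hx : x ∈ S <;> simp [hx]
    rw [this]
    simp [integral_indicator hS]
  have hwS : ((P ^ n) ∘ₘ ν).real S = ⟪(T ^ n) u, s⟫_ℝ := by
    rw [inner_pow_apply_left hsym, ← integral_comp_eq_inner hπ hf hk hdens hmS hSle]
    simp [integral_indicator hS]
  -- Since `T ^ n g` is orthogonal to constants, the indicator may be centred at `1/2`, where its
  -- modulus is constantly `1/2`; this is the factor in `D`.
  have hnorm : ‖s - (1 / 2 : ℝ) • one‖ = 1 / 2 := by
    rw [← sq_eq_sq₀ (norm_nonneg _) (by norm_num), ← real_inner_self_eq_norm_sq]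
    simp only [inner_sub_left, inner_sub_right, real_inner_smul_left, real_inner_smul_right]
    rw [real_inner_comm one s, hs1, hss, h11]
    ring
  have hdiff : ((P ^ n) ∘ₘ ν).real S - π.real S = ⟪(T ^ n) g, s - (1 / 2 : ℝ) • one⟫_ℝ := by
    rw [hwS, hTg, inner_add_left, hs1, inner_sub_right, real_inner_smul_right, hTg1]
    ring
  rw [hdiff, hcorr, ← norm_pow_apply_sq hsym, Real.sqrt_sq (norm_nonneg _)]
  exact (abs_real_inner_le_norm _ _).trans_eq (by rw [hnorm, mul_comm])

end Operator

/-! ### Regeneration from a general initial law, and the convergence bound. -/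

section RegenerationLaw

open Finset Filter Topology

/-- The law of the first regeneration time of the chain with initial law `μ`. -/
noncomputable def regenLaw (P N : Kernel X X) (C : Set X) (m : ℕ) (e : ℝ≥0∞) (μ : Measure X)
    (s : ℕ) : ℝ :=
  (∫⁻ x, regenProb P N C m e s x ∂μ).toReal

variable {P N : Kernel X X} {C : Set X} {m : ℕ} {e : ℝ≥0∞} {ν : Measure X}

theorem regenLaw_nonneg (μ : Measure X) (s : ℕ) : 0 ≤ regenLaw P N C m e μ s :=
  ENNReal.toReal_nonneg

theorem regenLaw_zero (hm : 1 ≤ m) (μ : Measure X) : regenLaw P N C m e μ 0 = 0 := by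
  simp [regenLaw, regenProb_zero hm]

variable [IsMarkovKernel P]

theorem sum_smul_comp_le (hC : MeasurableSet C) (hm : 1 ≤ m)
    (hN : ∀ x ∈ C, N x + e • ν = (P ^ m) x) (μ : Measure X) (t : ℕ) :
    ∑ s ∈ range (t + 1), (∫⁻ x, regenProb P N C m e s x ∂μ) • ((P ^ (t - s)) ∘ₘ ν)
      ≤ (P ^ t) ∘ₘ μ := by
  refine Measure.le_iff.2 fun S hS ↦ ?_
  rw [Measure.bind_apply hS (Kernel.aemeasurable _), Measure.finsetSum_apply]
  calc ∑ s ∈ range (t + 1), ((∫⁻ x, regenProb P N C m e s x ∂μ) • ((P ^ (t - s)) ∘ₘ ν)) S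
      = ∫⁻ x, ∑ s ∈ range (t + 1), regenProb P N C m e s x * ((P ^ (t - s)) ∘ₘ ν) S ∂μ := by
        rw [lintegral_finsetSum _ fun s _ ↦ (measurable_regenProb hC s).mul_const _]
        refine sum_congr rfl fun s _ ↦ ?_
        rw [lintegral_mul_const _ (measurable_regenProb hC s), Measure.smul_apply, smul_eq_mul]
    _ ≤ ∫⁻ x, (P ^ t) x S ∂μ := lintegral_mono fun x ↦ sum_regenProb_mul_le hC hm hN hS t x

variable [IsProbabilityMeasure ν]

theorem sum_regenProb_le_one (hC : MeasurableSet C) (hm : 1 ≤ m)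
    (hN : ∀ x ∈ C, N x + e • ν = (P ^ m) x) (t : ℕ) (x : X) :
    ∑ s ∈ range (t + 1), regenProb P N C m e s x ≤ 1 := by
  simpa using sum_regenProb_mul_le hC hm hN MeasurableSet.univ t x

theorem lintegral_regenProb_ne_top (hC : MeasurableSet C) (hm : 1 ≤ m)
    (hN : ∀ x ∈ C, N x + e • ν = (P ^ m) x) (μ : Measure X) [IsFiniteMeasure μ] (s : ℕ) :
    ∫⁻ x, regenProb P N C m e s x ∂μ ≠ ∞ := by
  refine ne_top_of_le_ne_top (measure_ne_top μ Set.univ) ?_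
  rw [← lintegral_one]
  exact lintegral_mono fun x ↦ (single_le_sum (f := fun s ↦ regenProb P N C m e s x)
    (fun _ _ ↦ zero_le) (mem_range.2 (Nat.lt_succ_self s))).trans
      (sum_regenProb_le_one hC hm hN s x)

theorem sum_regenLaw_mul_integral_le (hC : MeasurableSet C) (hm : 1 ≤ m)
    (hN : ∀ x ∈ C, N x + e • ν = (P ^ m) x) (μ : Measure X) [IsProbabilityMeasure μ]
    {f : X → ℝ} (hf : Measurable f) (hf0 : ∀ x, 0 ≤ f x) {k : ℝ} (hk : ∀ x, f x ≤ k) (t : ℕ) :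
    ∑ s ∈ range (t + 1), regenLaw P N C m e μ s * ∫ x, f x ∂((P ^ (t - s)) ∘ₘ ν)
      ≤ ∫ x, f x ∂((P ^ t) ∘ₘ μ) := by
  have hk' : ∀ x, |f x| ≤ k := fun x ↦ by rw [abs_of_nonneg (hf0 x)]; exact hk x
  refine le_trans (le_of_eq ?_) (integral_mono_measure (sum_smul_comp_le hC hm hN μ t)
    (.of_forall hf0) (integrable_of_bounded hf hk'))
  rw [integral_finsetSum_measure]
  · simp only [integral_smul_measure, smul_eq_mul, regenLaw]
  · intro s _
    exact (integrable_of_bounded hf hk').smul_measure (lintegral_regenProb_ne_top hC hm hN μ s)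

theorem sum_regenLaw_mul_real_le (hC : MeasurableSet C) (hm : 1 ≤ m)
    (hN : ∀ x ∈ C, N x + e • ν = (P ^ m) x) (μ : Measure X) [IsProbabilityMeasure μ]
    {S : Set X} (hS : MeasurableSet S) (t : ℕ) :
    ∑ s ∈ range (t + 1), regenLaw P N C m e μ s * ((P ^ (t - s)) ∘ₘ ν).real S
      ≤ ((P ^ t) ∘ₘ μ).real S := by
  have := sum_regenLaw_mul_integral_le hC hm hN μ (f := S.indicator fun _ ↦ (1 : ℝ))
    (measurable_const.indicator hS) (fun x ↦ Set.indicator_nonneg (fun _ _ ↦ zero_le_one) x)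
    (k := 1) (fun x ↦ Set.indicator_le_self' (fun _ _ ↦ zero_le_one) x) t
  simpa [integral_indicator hS] using this

theorem sum_regenLaw_le_one (hC : MeasurableSet C) (hm : 1 ≤ m)
    (hN : ∀ x ∈ C, N x + e • ν = (P ^ m) x) (μ : Measure X) [IsProbabilityMeasure μ] (t : ℕ) :
    ∑ s ∈ range (t + 1), regenLaw P N C m e μ s ≤ 1 := by
  simpa using sum_regenLaw_mul_real_le hC hm hN μ MeasurableSet.univ t

theorem lintegral_sum_regenProb_eq (hC : MeasurableSet C) (hm : 1 ≤ m)
    (hN : ∀ x ∈ C, N x + e • ν = (P ^ m) x) (μ : Measure X) [IsProbabilityMeasure μ] (t : ℕ) :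
    ∫⁻ x, ∑ s ∈ range (t + 1), regenProb P N C m e s x ∂μ
      = ENNReal.ofReal (∑ s ∈ range (t + 1), regenLaw P N C m e μ s) := by
  rw [lintegral_finsetSum _ fun s _ ↦ measurable_regenProb hC s,
    ENNReal.ofReal_sum_of_nonneg fun s _ ↦ regenLaw_nonneg μ s]
  exact sum_congr rfl fun s _ ↦ (ENNReal.ofReal_toReal
    (lintegral_regenProb_ne_top hC hm hN μ s)).symm

variable {W : X → ℝ≥0∞} {ρ : ℝ} {c : ℝ≥0∞}

theorem one_sub_sum_regenLaw_le (hC : MeasurableSet C) (hm : 1 ≤ m)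
    (hN : ∀ x ∈ C, N x + e • ν = (P ^ m) x) (hW : Measurable W)
    (hW1 : ∀ x, 1 ≤ W x) (hρ : 0 ≤ ρ) (hc : ∀ t < m, 1 ≤ c * ENNReal.ofReal ρ ^ t)
    (hoff : ∀ x ∉ C, ∫⁻ y, W y ∂(P x) ≤ ENNReal.ofReal ρ * W x)
    (hon : ∀ x ∈ C, ∫⁻ y, W y ∂(N x) ≤ ENNReal.ofReal ρ ^ m)
    (μ : Measure X) [IsProbabilityMeasure μ] {A : ℝ} (hA0 : 0 ≤ A)
    (hA : c * ∫⁻ x, W x ∂μ ≤ ENNReal.ofReal A) (t : ℕ) :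
    1 - ∑ s ∈ range (t + 1), regenLaw P N C m e μ s ≤ A * ρ ^ t := by
  have h1 : (1 : ℝ≥0∞) ≤ ∫⁻ x, (∑ s ∈ range (t + 1), regenProb P N C m e s x
      + c * ENNReal.ofReal ρ ^ t * W x) ∂μ := by
    calc (1 : ℝ≥0∞) = ∫⁻ _, 1 ∂μ := by simp
      _ ≤ _ := lintegral_mono fun x ↦ one_le_sum_regenProb_add hC hm hN hW hW1 hc hoff hon t x
  rw [lintegral_add_right _ (hW.const_mul _), lintegral_const_mul _ hW,
    lintegral_sum_regenProb_eq hC hm hN μ] at h1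
  have hs : 0 ≤ ∑ s ∈ range (t + 1), regenLaw P N C m e μ s :=
    sum_nonneg fun s _ ↦ regenLaw_nonneg μ s
  have h2 : (1 : ℝ≥0∞) ≤
      ENNReal.ofReal (∑ s ∈ range (t + 1), regenLaw P N C m e μ s + A * ρ ^ t) := by
    rw [ENNReal.ofReal_add hs (by positivity), ENNReal.ofReal_mul hA0, ENNReal.ofReal_pow hρ]
    refine h1.trans (add_le_add_right ?_ _)
    rw [mul_right_comm]
    exact mul_le_mul_left hA _
  rw [ENNReal.one_le_ofReal] at h2
  linarith

/-- Regeneration is almost sure from each point, since `W` is finite there. The limit is taken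
pointwise before integrating because `W` is not assumed `μ`-integrable; this matters for `μ = π`. -/
theorem tendsto_sum_regenLaw (hC : MeasurableSet C) (hm : 1 ≤ m)
    (hN : ∀ x ∈ C, N x + e • ν = (P ^ m) x) (hW : Measurable W)
    (hW1 : ∀ x, 1 ≤ W x) (hWtop : ∀ x, W x ≠ ∞) (hρ : ρ < 1) (hctop : c ≠ ∞)
    (hc : ∀ t < m, 1 ≤ c * ENNReal.ofReal ρ ^ t)
    (hoff : ∀ x ∉ C, ∫⁻ y, W y ∂(P x) ≤ ENNReal.ofReal ρ * W x)
    (hon : ∀ x ∈ C, ∫⁻ y, W y ∂(N x) ≤ ENNReal.ofReal ρ ^ m)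
    (μ : Measure X) [IsProbabilityMeasure μ] :
    Tendsto (fun t ↦ ∑ s ∈ range (t + 1), regenLaw P N C m e μ s) atTop (𝓝 1) := by
  have hx : ∀ x, ∑' s, regenProb P N C m e s x = 1 := by
    intro x
    have h1 := (ENNReal.tendsto_nat_tsum fun s ↦ regenProb P N C m e s x).comp
      (tendsto_add_atTop_nat 1)
    refine le_antisymm (le_of_tendsto' h1 fun t ↦ sum_regenProb_le_one hC hm hN t x) ?_
    have h2 : Tendsto (fun t ↦ c * ENNReal.ofReal ρ ^ t * W x) atTop (𝓝 0) := by
      have := ENNReal.Tendsto.mul_const (b := W x) (ENNReal.Tendsto.const_mul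
        (ENNReal.tendsto_pow_atTop_nhds_zero_of_lt_one (ENNReal.ofReal_lt_one.2 hρ))
        (Or.inr hctop)) (Or.inr (hWtop x))
      simpa using this
    have h3 := ge_of_tendsto' (h1.add h2) fun t ↦
      one_le_sum_regenProb_add hC hm hN hW hW1 hc hoff hon t x
    simpa using h3
  have h1 : ∑' s, ∫⁻ x, regenProb P N C m e s x ∂μ = 1 := by
    rw [← lintegral_tsum fun s ↦ (measurable_regenProb hC s).aemeasurable]
    simp [hx]
  have h2 := ((ENNReal.tendsto_nat_tsum fun s ↦ ∫⁻ x, regenProb P N C m e s x ∂μ).comp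
      (tendsto_add_atTop_nat 1))
  rw [h1] at h2
  have h3 := (ENNReal.tendsto_toReal ENNReal.one_ne_top).comp h2
  rw [ENNReal.toReal_one] at h3
  refine h3.congr fun t ↦ ?_
  exact ENNReal.toReal_sum fun s _ ↦ lintegral_regenProb_ne_top hC hm hN μ s

/-- Distance to equilibrium from the regeneration decomposition. -/
theorem abs_sub_le_of_regeneration {p z : ℕ → ℝ} {A D ρ y b : ℝ} {t : ℕ}
    (hρ0 : 0 < ρ) (hρ1 : ρ < 1) (hD : 0 ≤ D) (hb0 : 0 ≤ b) (hb1 : b ≤ 1) (hp : ∀ s, 0 ≤ p s)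
    (hp1 : ∑ s ∈ range (t + 1), p s ≤ 1)
    (hq : ∀ n, 1 - ∑ s ∈ range (n + 1), p s ≤ A * ρ ^ n)
    (hz : ∀ k, |z k - b| ≤ D * ρ ^ k)
    (hlow : ∑ s ∈ range (t + 1), p s * z (t - s) ≤ y)
    (hup : ∑ s ∈ range (t + 1), p s * (1 - z (t - s)) ≤ 1 - y) :
    |y - b| ≤ ((1 - ρ) / ρ * D * A * t + max (1 - D) 0 * A + D) * ρ ^ t := by
  have hsum := mul_le_mul_of_nonneg_left (sum_mul_pow_le_of_tail_le hρ0 hρ1.le hq t) hD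
  have hqt := hq t
  set σ := ∑ s ∈ range (t + 1), p s with hσ
  set u := ∑ s ∈ range (t + 1), p s * ρ ^ (t - s) with hu
  have h1 : σ * b - D * u ≤ y := by
    refine le_trans (le_of_eq ?_) ((sum_le_sum (f := fun s ↦ p s * (b - D * ρ ^ (t - s)))
      fun s _ ↦ mul_le_mul_of_nonneg_left ?_ (hp s)).trans hlow)
    · simp only [mul_sub, sum_sub_distrib, ← sum_mul, hσ, hu, mul_sum]
      congr 1
      exact sum_congr rfl fun s _ ↦ by ring
    · linarith [(abs_le.1 (hz (t - s))).1]
  have h2 : σ * (1 - b) - D * u ≤ 1 - y := by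
    refine le_trans (le_of_eq ?_) ((sum_le_sum (f := fun s ↦ p s * (1 - b - D * ρ ^ (t - s)))
      fun s _ ↦ mul_le_mul_of_nonneg_left ?_ (hp s)).trans hup)
    · simp only [mul_sub, sum_sub_distrib, ← sum_mul, hσ, hu, mul_sum]
      congr 1
      exact sum_congr rfl fun s _ ↦ by ring
    · linarith [(abs_le.1 (hz (t - s))).2]
  have h3 : |y - b| ≤ D * u + (1 - σ) := by
    rw [abs_le]
    constructor <;> nlinarith
  -- The Abel bound `hsum` returns `-D (1 - σ)`, so the unregenerated mass enters with coefficient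
  -- `1 - D`, which is discarded when negative.
  have h4 : (1 - D) * (1 - σ) ≤ max (1 - D) 0 * (A * ρ ^ t) :=
    (mul_le_mul_of_nonneg_right (le_max_left _ _) (by linarith)).trans
      (mul_le_mul_of_nonneg_left hqt (le_max_right _ _))
  have h5 : ((1 - ρ) / ρ * D * A * t + max (1 - D) 0 * A + D) * ρ ^ t
      = D * (ρ ^ t + (1 - ρ) / ρ * A * t * ρ ^ t) + max (1 - D) 0 * (A * ρ ^ t) := by ring
  rw [h5]
  linarith

/-- Quantitative ergodicity of a reversible chain with nonnegative eigenvalues from a function `W`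
controlling the tail of the regeneration time. -/
theorem abs_real_sub_le (π : Measure X) [IsProbabilityMeasure π] (hrev : P.IsReversible π)
    (hspec : HasNonnegativeEigenvalues P π hrev) (hC : MeasurableSet C) (hm : 1 ≤ m)
    (hN : ∀ x ∈ C, N x + e • ν = (P ^ m) x) (hW : Measurable W)
    (hW1 : ∀ x, 1 ≤ W x) (hWtop : ∀ x, W x ≠ ∞) (hρ0 : 0 < ρ) (hρ1 : ρ < 1) (hctop : c ≠ ∞)
    (hc : ∀ t < m, 1 ≤ c * ENNReal.ofReal ρ ^ t)
    (hoff : ∀ x ∉ C, ∫⁻ y, W y ∂(P x) ≤ ENNReal.ofReal ρ * W x)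
    (hon : ∀ x ∈ C, ∫⁻ y, W y ∂(N x) ≤ ENNReal.ofReal ρ ^ m)
    {Aν : ℝ} (hAν0 : 0 ≤ Aν) (hAν : c * ∫⁻ x, W x ∂ν ≤ ENNReal.ofReal Aν)
    {x : X} {A : ℝ} (hA0 : 0 ≤ A) (hA : c * W x ≤ ENNReal.ofReal A) {D : ℝ}
    (hD : D = 1 / 2 * √(Aν * ρ / (1 - ρ))) {S : Set X} (hS : MeasurableSet S) (t : ℕ) :
    |((P ^ t) x).real S - π.real S|
      ≤ ((1 - ρ) / ρ * D * A * t + max (1 - D) 0 * A + D) * ρ ^ t := by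
  have hπ := hrev.invariant
  have hw1 := tendsto_sum_regenLaw (ν := ν) hC hm hN hW hW1 hWtop hρ1 hctop hc hoff hon π
  obtain ⟨s₀, hs₀⟩ : ∃ s, 0 < regenLaw P N C m e π s := by
    by_contra! h
    have hz : ∀ s, regenLaw P N C m e π s = 0 := fun s ↦ le_antisymm (h s) (regenLaw_nonneg π s)
    simp only [hz, sum_const_zero] at hw1
    exact zero_ne_one (tendsto_nhds_unique tendsto_const_nhds hw1)
  -- Starting from `π`, the chain restarts exactly at time `s₀` with positive probability and is
  -- still distributed as `π` then.
  have hνπ : ν ≤ (((∫⁻ y, regenProb P N C m e s₀ y ∂π)⁻¹).toNNReal : ℝ≥0∞) • π := by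
    set a := ∫⁻ y, regenProb P N C m e s₀ y ∂π with ha
    have ha0 : a ≠ 0 := fun h ↦ by simp [regenLaw, ← ha, h] at hs₀
    have hatop : a ≠ ∞ := lintegral_regenProb_ne_top hC hm hN π s₀
    rw [ENNReal.coe_toNNReal (ENNReal.inv_ne_top.2 ha0)]
    refine Measure.le_iff.2 fun U hU ↦ ?_
    have h1 := Measure.le_iff.1 (sum_smul_comp_le hC hm hN π s₀) U hU
    rw [(invariant_pow hπ s₀ : (P ^ s₀) ∘ₘ π = π), Measure.finsetSum_apply] at h1
    have h2 : a * ν U ≤ π U := by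
      refine le_trans ?_ h1
      refine le_trans (le_of_eq ?_) (single_le_sum (f := fun s ↦
        ((∫⁻ y, regenProb P N C m e s y ∂π) • ((P ^ (s₀ - s)) ∘ₘ ν)) U)
        (fun _ _ ↦ zero_le) (mem_range.2 (Nat.lt_succ_self s₀)))
      have : (P ^ (s₀ - s₀)) ∘ₘ ν = ν := by
        rw [Nat.sub_self]; exact Measure.id_comp
      rw [this, Measure.smul_apply, smul_eq_mul]
    rw [Measure.smul_apply, smul_eq_mul, mul_comm, ← div_eq_mul_inv,
      ENNReal.le_div_iff_mul_le (Or.inl ha0) (Or.inl hatop), mul_comm]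
    exact h2
  obtain ⟨f, hf, hf0, hfk, hdens⟩ := exists_bounded_density hνπ
  have hfk' := fun x ↦ (abs_of_nonneg (hf0 x)).trans_le (hfk x)
  have hcor := correlation_bounds hrev hspec hf hfk' hdens
  set a : ℕ → ℝ := fun n ↦ (∫ x, f x ∂((P ^ n) ∘ₘ ν)) - 1 with ha
  have ha1 : ∀ n, a n + 1 = ∫ x, f x ∂((P ^ n) ∘ₘ ν) := fun n ↦ sub_add_cancel _ _
  have hfπ : ∫ x, f x ∂π = 1 := by simpa using (hdens fun _ ↦ 1).symm
  have hbound : ∀ n, a n ≤ Aν * ρ / (1 - ρ) * ρ ^ n := by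
    refine renewal_bound hρ0.le hρ1 (fun n ↦ (hcor n).1) (regenLaw_zero (P := P) (N := N)
      (C := C) (e := e) hm ν) (sum_regenLaw_le_one hC hm hN ν)
      (one_sub_sum_regenLaw_le hC hm hN hW hW1 hρ0.le hc hoff hon ν hAν0 hAν) (fun n ↦ ?_)
      (regenLaw_nonneg (P := P) (N := N) (C := C) (m := m) (e := e) π) hw1 (fun n ↦ ?_)
    · simp only [ha1]
      exact sum_regenLaw_mul_integral_le hC hm hN ν hf hf0 hfk n
    · simp only [ha1]
      refine (sum_regenLaw_mul_integral_le hC hm hN π hf hf0 hfk n).trans_eq ?_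
      rw [(invariant_pow hπ n : (P ^ n) ∘ₘ π = π), hfπ]
  have hD0 : 0 ≤ D := by rw [hD]; positivity
  have hz : ∀ n : ℕ, |((P ^ n) ∘ₘ ν).real S - π.real S| ≤ D * ρ ^ n := by
    intro n
    refine ((hcor n).2 S hS).trans ?_
    have h1 : √(a (2 * n)) ≤ √(Aν * ρ / (1 - ρ)) * ρ ^ n := by
      rw [← Real.sqrt_sq (pow_nonneg hρ0.le n), ← Real.sqrt_mul'  _ (by positivity), ← pow_mul,
        mul_comm n 2]
      exact Real.sqrt_le_sqrt (hbound _)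
    rw [hD]
    linarith
  have hdirac : (P ^ t) ∘ₘ (Measure.dirac x) = (P ^ t) x :=
    Measure.dirac_bind (Kernel.measurable _) x
  have hWx : c * ∫⁻ y, W y ∂(Measure.dirac x) ≤ ENNReal.ofReal A := by
    rwa [lintegral_dirac' _ hW]
  refine abs_sub_le_of_regeneration (p := regenLaw P N C m e (Measure.dirac x))
    (z := fun n ↦ ((P ^ n) ∘ₘ ν).real S) hρ0 hρ1 hD0 measureReal_nonneg measureReal_le_one
    (regenLaw_nonneg _) (sum_regenLaw_le_one hC hm hN _ t)
    (one_sub_sum_regenLaw_le hC hm hN hW hW1 hρ0.le hc hoff hon _ hA0 hWx) hz ?_ ?_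
  · rw [← hdirac]
    exact sum_regenLaw_mul_real_le hC hm hN _ hS t
  -- The upper estimate for `S` is the lower estimate for its complement.
  · rw [← hdirac, ← probReal_compl_eq_one_sub hS]
    simp only [← probReal_compl_eq_one_sub hS]
    exact sum_regenLaw_mul_real_le hC hm hN _ hS.compl t

end RegenerationLaw

/-! ### Drift of the power `V^r`. -/

section DriftPower

variable {P N : Kernel X X} {C : Set X} {V : X → ℝ} {lam K ε : ℝ} {m : ℕ}
  {ν : Measure X}

theorem IsSmallSet.smul_le (h : IsSmallSet P C m ε ν) {x : X} (hx : x ∈ C) :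
    ENNReal.ofReal ε • ν ≤ (P ^ m) x :=
  Measure.le_iff.2 fun S hS ↦ h.minorization x hx S hS

theorem IsDriftFunction.univ_le_lintegral (h : IsDriftFunction P C V lam K) (μ : Measure X) :
    μ Set.univ ≤ ∫⁻ y, ENNReal.ofReal (V y) ∂μ := by
  rw [← lintegral_one]
  exact lintegral_mono fun y ↦ ENNReal.one_le_ofReal.2 (h.one_le y)

variable [IsMarkovKernel P]

theorem IsSmallSet.eps_le_one (h : IsSmallSet P C m ε ν) (hC : C.Nonempty) : ε ≤ 1 := by
  obtain ⟨x, hx⟩ := hC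
  have := h.isProbabilityMeasure
  have h1 := h.minorization x hx Set.univ .univ
  rwa [measure_univ, measure_univ, mul_one, ENNReal.ofReal_le_one] at h1

theorem residual_univ [IsProbabilityMeasure ν] (hε0 : 0 ≤ ε) {x : X}
    (hN : N x + ENNReal.ofReal ε • ν = (P ^ m) x) :
    N x Set.univ = ENNReal.ofReal (1 - ε) := by
  have h1 : N x Set.univ + ENNReal.ofReal ε = 1 := by
    simpa using congrArg (fun μ : Measure X ↦ μ Set.univ) hN
  rw [ENNReal.ofReal_sub _ hε0, ENNReal.ofReal_one]
  exact ENNReal.eq_sub_of_add_eq ENNReal.ofReal_ne_top h1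

theorem IsDriftFunction.lintegral_rpow_le (h : IsDriftFunction P C V lam K) (hlam : 0 < lam)
    (hρ : rate lam K m ε < 1) {x : X} (hx : x ∉ C) :
    ∫⁻ y, ENNReal.ofReal (V y) ^ expo lam K m ε ∂(P x)
      ≤ ENNReal.ofReal (rate lam K m ε) * ENNReal.ofReal (V x) ^ expo lam K m ε := by
  have hl := h.lam_lt_one
  have hr0 := expo_pos (K := K) (m := m) (ε := ε) hlam hl hρ
  refine (lintegral_rpow_le_rpow_lintegral _ h.measurable.ennreal_ofReal.aemeasurable hr0.le
    (expo_le_one hlam hl)).trans ?_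
  rw [measure_univ, ENNReal.one_rpow, mul_one, ← lam_rpow_expo hlam hl,
    ← ENNReal.ofReal_rpow_of_pos hlam, ← ENNReal.mul_rpow_of_nonneg _ _ hr0.le,
    ← ENNReal.ofReal_mul hlam.le]
  exact ENNReal.rpow_le_rpow (h.drift_off x hx) hr0.le

variable [Nonempty X]

theorem IsDriftFunction.lintegral_residual_add_le (h : IsDriftFunction P C V lam K)
    (hlam : 0 < lam) (hm : 1 ≤ m) {x : X} (hx : x ∈ C)
    (hN : N x + ENNReal.ofReal ε • ν = (P ^ m) x) :
    ∫⁻ y, ENNReal.ofReal (V y) ∂(N x) + ENNReal.ofReal ε * ∫⁻ y, ENNReal.ofReal (V y) ∂ν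
      ≤ ENNReal.ofReal (constB lam K m) := by
  refine le_trans (le_of_eq ?_) (h.lintegral_pow_le hlam hm hx)
  rw [← hN, lintegral_add_measure, lintegral_smul_measure, smul_eq_mul]

/-- Because `V ≥ 1`, the `ν` part uses at least `ε` of the budget `B`, leaving `B - ε` for `N`,
whose mass is `1 - ε`; Hölder then reduces to `rpow_mul_rpow_le_rate_pow`. -/
theorem IsDriftFunction.lintegral_residual_rpow_le [IsProbabilityMeasure ν]
    (h : IsDriftFunction P C V lam K) (hlam : 0 < lam) (hm : 1 ≤ m) (hε0 : 0 < ε) (hε1 : ε ≤ 1)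
    {x : X} (hx : x ∈ C) (hN : N x + ENNReal.ofReal ε • ν = (P ^ m) x) :
    ∫⁻ y, ENNReal.ofReal (V y) ^ expo lam K m ε ∂(N x)
      ≤ ENNReal.ofReal (rate lam K m ε) ^ m := by
  have hK := h.one_le_bound hlam
  have hl := h.lam_lt_one
  have hB := one_le_constB (m := m) hlam hl hK
  have huniv := residual_univ hε0.le hN
  rcases hε1.eq_or_lt with rfl | hε
  · have h0 : N x = 0 := Measure.measure_univ_eq_zero.1 (by rw [huniv]; simp)
    rw [h0, lintegral_zero_measure]
    exact zero_le
  have hr0 := expo_pos (K := K) (m := m) (ε := ε) hlam hl (rate_lt_one hlam hl hB hm hε0 hε1)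
  have hr1 := expo_le_one (K := K) (m := m) (ε := ε) hlam hl
  have hNV : ∫⁻ y, ENNReal.ofReal (V y) ∂(N x) ≤ ENNReal.ofReal (constB lam K m - ε) := by
    rw [ENNReal.ofReal_sub _ hε0.le]
    refine ENNReal.le_sub_of_add_le_right ENNReal.ofReal_ne_top
      (le_trans ?_ (h.lintegral_residual_add_le hlam hm hx hN))
    refine add_le_add_right ?_ _
    have := h.univ_le_lintegral ν
    rw [measure_univ] at this
    exact le_mul_of_one_le_right' this
  calc ∫⁻ y, ENNReal.ofReal (V y) ^ expo lam K m ε ∂(N x)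
      ≤ (∫⁻ y, ENNReal.ofReal (V y) ∂(N x)) ^ expo lam K m ε
          * N x Set.univ ^ (1 - expo lam K m ε) :=
        lintegral_rpow_le_rpow_lintegral _ h.measurable.ennreal_ofReal.aemeasurable hr0.le hr1
    _ ≤ ENNReal.ofReal (constB lam K m - ε) ^ expo lam K m ε
          * ENNReal.ofReal (1 - ε) ^ (1 - expo lam K m ε) := by
        rw [huniv]
        exact mul_le_mul_left (ENNReal.rpow_le_rpow hNV hr0.le) _
    _ ≤ ENNReal.ofReal (rate lam K m ε) ^ m := by
        rw [ENNReal.ofReal_rpow_of_pos (by linarith), ENNReal.ofReal_rpow_of_pos (by linarith),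
          ← ENNReal.ofReal_mul (by have : 0 < constB lam K m - ε := by linarith
                                   positivity),
          ← ENNReal.ofReal_pow (hlam.trans_le lam_le_rate).le]
        exact ENNReal.ofReal_le_ofReal (rpow_mul_rpow_le_rate_pow hlam hl hB hm hε)

/-- The same budget read the other way: `N` uses at least its mass `1 - ε`, which leaves `B - (1 -
ε)` for `ε ∫ V dν`. -/
theorem IsDriftFunction.lintegral_regeneration_rpow_le [IsProbabilityMeasure ν]
    (h : IsDriftFunction P C V lam K) (hlam : 0 < lam) (hm : 1 ≤ m) (hε0 : 0 < ε) (hε1 : ε ≤ 1)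
    {x : X} (hx : x ∈ C) (hN : N x + ENNReal.ofReal ε • ν = (P ^ m) x) :
    ∫⁻ y, ENNReal.ofReal (V y) ^ expo lam K m ε ∂ν
      ≤ ENNReal.ofReal (((constB lam K m - (1 - ε)) / ε) ^ expo lam K m ε) := by
  have hl := h.lam_lt_one
  have hB := one_le_constB (m := m) hlam hl (h.one_le_bound hlam)
  have hr0 := expo_pos (K := K) (m := m) (ε := ε) hlam hl (rate_lt_one hlam hl hB hm hε0 hε1)
  have hr1 := expo_le_one (K := K) (m := m) (ε := ε) hlam hl
  have hνV : ∫⁻ y, ENNReal.ofReal (V y) ∂ν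
      ≤ ENNReal.ofReal ((constB lam K m - (1 - ε)) / ε) := by
    rw [ENNReal.ofReal_div_of_pos hε0, ENNReal.le_div_iff_mul_le
      (Or.inl (by simpa using hε0)) (Or.inl ENNReal.ofReal_ne_top),
      ENNReal.ofReal_sub _ (by linarith), mul_comm]
    refine ENNReal.le_sub_of_add_le_left ENNReal.ofReal_ne_top
      (le_trans ?_ (h.lintegral_residual_add_le hlam hm hx hN))
    refine add_le_add_left ?_ _
    rw [← residual_univ hε0.le hN]
    exact h.univ_le_lintegral _
  refine (lintegral_rpow_le_rpow_lintegral _ h.measurable.ennreal_ofReal.aemeasurable hr0.le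
    hr1).trans ?_
  rw [measure_univ, ENNReal.one_rpow, mul_one,
    ← ENNReal.ofReal_rpow_of_pos (div_pos (by linarith) hε0)]
  exact ENNReal.rpow_le_rpow hνV hr0.le

end DriftPower

end DriftMinorization

/-! ### The main theorem, with `W = V^r` and `c = ρ^(1-m)`. -/

open DriftMinorization

theorem theorem1p7 {X : Type*} [MeasurableSpace X]
    (P : Kernel X X) [IsMarkovKernel P] (π : Measure X) [IsProbabilityMeasure π]
    (hrev : P.IsReversible π)
    (hspec : DriftMinorization.HasNonnegativeEigenvalues P π hrev)
    (C : Set X) (hC : MeasurableSet C)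
    (V : X → ℝ) (lam K : ℝ) (hlam : 0 < lam)
    (hdrift : DriftMinorization.IsDriftFunction P C V lam K)
    (m : ℕ) (ε : ℝ) (ν : Measure X)
    (hsmall : DriftMinorization.IsSmallSet P C m ε ν) :
    DriftMinorization.rate lam K m ε < 1 ∧
      ∀ (x : X) (t : ℕ),
        DriftMinorization.tvDist ((P ^ t) x) π ≤
          DriftMinorization.funF lam K m ε (V x) t * DriftMinorization.rate lam K m ε ^ t := by
  have hX : Nonempty X := nonempty_of_isProbabilityMeasure π
  have hν : IsProbabilityMeasure ν := hsmall.isProbabilityMeasure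
  have hεν : IsFiniteMeasure (ENNReal.ofReal ε • ν) := ν.smul_finite ENNReal.ofReal_ne_top
  have hm := hsmall.one_le
  have hε0 := hsmall.eps_pos
  have hl := hdrift.lam_lt_one
  have hne := hdrift.nonempty hlam
  have hε1 := hsmall.eps_le_one hne
  have hB := one_le_constB (m := m) hlam hl (hdrift.one_le_bound hlam)
  have hρ1 := rate_lt_one hlam hl hB hm hε0 hε1
  refine ⟨hρ1, fun x t ↦ ?_⟩
  have hρ0 : 0 < rate lam K m ε := hlam.trans_le lam_le_rate
  have hr0 := expo_pos hlam hl hρ1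
  have hV0 : ∀ y, 0 < V y := fun y ↦ zero_lt_one.trans_le (hdrift.one_le y)
  obtain ⟨N, hN⟩ := exists_residual_kernel (P ^ m) hC (ENNReal.ofReal ε • ν)
    fun y hy ↦ hsmall.smul_le hy
  obtain ⟨x₀, hx₀⟩ := hne
  have hc0 : 0 ≤ rate lam K m ε ^ (1 - (m : ℤ)) := zpow_nonneg hρ0.le _
  have hbase : 0 ≤ (constB lam K m - (1 - ε)) / ε := div_nonneg (by linarith) hε0.le
  have : Nonempty {S : Set X // MeasurableSet S} := ⟨⟨∅, .empty⟩⟩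
  refine ciSup_le fun S ↦ ?_
  refine abs_real_sub_le (N := N) (m := m) (e := ENNReal.ofReal ε) (ν := ν)
    (W := fun y ↦ ENNReal.ofReal (V y) ^ expo lam K m ε)
    (c := ENNReal.ofReal (rate lam K m ε ^ (1 - (m : ℤ)))) (Aν := constAν lam K m ε)
    π hrev hspec hC hm hN
    (hdrift.measurable.ennreal_ofReal.pow_const _)
    (fun y ↦ ENNReal.one_le_rpow (ENNReal.one_le_ofReal.2 (hdrift.one_le y)) hr0)
    (fun y ↦ ENNReal.rpow_ne_top_of_nonneg hr0.le ENNReal.ofReal_ne_top) hρ0 hρ1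
    ENNReal.ofReal_ne_top (fun s hs ↦ ?_) (fun y hy ↦ hdrift.lintegral_rpow_le hlam hρ1 hy)
    (fun y hy ↦ hdrift.lintegral_residual_rpow_le hlam hm hε0 hε1 hy (hN y hy))
    (mul_nonneg (Real.rpow_nonneg hbase _) hc0) ?_
    (mul_nonneg (Real.rpow_nonneg (hV0 x).le _) hc0) ?_ rfl S.2 t
  -- For `s < m` the exponent `1 - m + s` is at most zero; this is why `A` carries the factor
  -- `ρ^(1-m)`.
  · rw [← ENNReal.ofReal_pow hρ0.le, ← ENNReal.ofReal_mul hc0, ENNReal.one_le_ofReal,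
      ← zpow_natCast, ← zpow_add₀ hρ0.ne']
    exact one_le_zpow_of_nonpos₀ hρ0 hρ1.le (by omega)
  · rw [constAν, mul_comm, ENNReal.ofReal_mul (Real.rpow_nonneg hbase _)]
    exact mul_le_mul_left
      (hdrift.lintegral_regeneration_rpow_le hlam hm hε0 hε1 hx₀ (hN x₀ hx₀)) _
  · rw [ENNReal.ofReal_rpow_of_pos (hV0 x), mul_comm,
      ← ENNReal.ofReal_mul (Real.rpow_nonneg (hV0 x).le _)]
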